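/- For each $n\ge 1$ let $M_n$ be a random $n\times n$ matrix chosen uniformly among all $n\times n$ matrices with entries in $\{-1,1\}$ (equivalently, the entries of $M_n$ are i.i.d. and equal to $\pm1$ with probability $1/2$ each). Then $$\mathbf P\Bigl(|\det M_n| \ge \sqrt{n!}\,\exp\bigl(-29\sqrt{n\ln n}\bigr)\Bigr) \longrightarrow 1 \qquad (n\to\infty).$$ Moreover, there is an absolute constant $C>0$ such that, for each choice of sign $\sigma\in\{+1,-1\}$, $$\mathbf P\Bigl(\sqrt{n!}\,\exp\bigl(-C\sqrt{n\ln n}\bigr) \le \sigma\det M_n \le \sqrt{n!}\,\exp\bigl(C\sqrt{n\ln n}\bigr)\Bigr) \longrightarrow \tfrac12 \qquad (n\to\infty).$$ -/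

import Mathlib

open Filter Topology MeasureTheory ProbabilityTheory
open scoped Nat

/-- The set of `n × n` real matrices all of whose entries are `1` or `-1`. -/
def signMatrices (n : ℕ) : Set (Matrix (Fin n) (Fin n) ℝ) :=
  {M | ∀ i j, M i j = 1 ∨ M i j = -1}

/-- The product (Borel) `σ`-algebra on the space of `n × n` real matrices. -/
instance realMatrixMeasurableSpace (n : ℕ) : MeasurableSpace (Matrix (Fin n) (Fin n) ℝ) :=
  inferInstanceAs (MeasurableSpace (Fin n → Fin n → ℝ))

instance realMatrixMeasurableSingletonClass (n : ℕ) :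
    MeasurableSingletonClass (Matrix (Fin n) (Fin n) ℝ) :=
  inferInstanceAs (MeasurableSingletonClass (Fin n → Fin n → ℝ))

/-- The law of the random `n × n` Bernoulli matrix: the uniform probability measure on the
finite set of `±1` matrices (equivalently, the entries are i.i.d. uniform signs). -/
noncomputable def bernoulliMatrix (n : ℕ) : Measure (Matrix (Fin n) (Fin n) ℝ) :=
  uniformOn (signMatrices n)

theorem signMatrices_finite (n : ℕ) : (signMatrices n).Finite := by
  have h : (Set.pi Set.univ fun _ : Fin n => Set.pi Set.univ fun _ : Fin n =>
      ({1, -1} : Set ℝ)).Finite :=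
    Set.Finite.pi fun _ => Set.Finite.pi fun _ => by simp
  refine h.subset fun M hM => ?_
  exact fun i _ j _ => by simpa using hM i j

theorem signMatrices_nonempty (n : ℕ) : (signMatrices n).Nonempty :=
  ⟨fun _ _ => 1, fun _ _ => Or.inl rfl⟩

instance bernoulliMatrix_isProbabilityMeasure (n : ℕ) :
    IsProbabilityMeasure (bernoulliMatrix n) :=
  isProbabilityMeasure_uniformOn (signMatrices_finite n) (signMatrices_nonempty n)

/-! By Gram–Schmidt, `signDet A ^ 2` is bounded below by the product over `d` of the squared
distance from row `d` to the span of the preceding rows. Given those rows, this is the squared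
length of a random sign vector projected to a space of dimension `r ≥ n - d`; it has mean `r` and
variance at most `2 * r`. Since the product of the `n - d` is `n!`, the lower bound is a law of
large numbers for logarithms: the expected total relative deviation is of order `∑ 1 / √j`, that is
`√n`, and Markov's inequality with threshold `√(n log n)` suffices.

The logarithm is controlled only if no distance is tiny. While the codimension is at least `k`, a
robust Odlyzko lemma (`freq_forall_abs_sum_lt_one_le`) gives failure probabilities summing to `O(2 ^
(-k))`. For the fewer than `k + 1` remaining rows, a counting argument
(`freq_exists_concentrated_normal_le`) shows that every normal vector to the earlier rows has many
non-negligible coordinates, and Littlewood–Offord applies. These rows cost a fixed power of `n`,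
negligible against `exp (√(n log n))`.

The upper bound is Markov's inequality for `expect_signDet_sq`. Negating a row reverses the sign of
the determinant, so each sign receives half of the mass. -/

/-! ### Uniform probability on a finite type -/

section UniformProbability

open scoped BigOperators

variable {α β : Type*} [Fintype α] [Fintype β]

open Classical in
/-- The proportion of the elements of a finite type that satisfy a predicate. -/
noncomputable def freq (p : α → Prop) : ℝ := 𝔼 a, if p a then 1 else 0

lemma freq_nonneg (p : α → Prop) : 0 ≤ freq p :=
  Finset.expect_nonneg fun a _ => by split_ifs <;> norm_num

lemma expect_mono' {f g : α → ℝ} (h : ∀ a, f a ≤ g a) : 𝔼 a, f a ≤ 𝔼 a, g a :=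
  Finset.expect_le_expect fun a _ => h a

lemma freq_mono {p q : α → Prop} (h : ∀ a, p a → q a) : freq p ≤ freq q :=
  expect_mono' fun a => by
    by_cases hp : p a
    · simp [hp, h a hp]
    · simp only [hp, if_false]; split_ifs <;> norm_num

lemma freq_congr {p q : α → Prop} (h : ∀ a, p a ↔ q a) : freq p = freq q := by
  congr 1; ext a; exact h a

lemma freq_eq_card_div (p : α → Prop) [DecidablePred p] :
    freq p = (Finset.univ.filter p).card / Fintype.card α := by
  rw [freq, Fintype.expect_eq_sum_div_card, Finset.card_filter]
  push_cast
  congr!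

lemma freq_le_one (p : α → Prop) : freq p ≤ 1 := by
  classical
  rw [freq_eq_card_div]
  refine div_le_one_of_le₀ ?_ (Nat.cast_nonneg _)
  exact_mod_cast Finset.card_le_univ _

lemma freq_or_le (p q : α → Prop) : freq (fun a => p a ∨ q a) ≤ freq p + freq q := by
  unfold freq
  rw [← Finset.expect_add_distrib]
  refine expect_mono' fun a => ?_
  by_cases hp : p a <;> by_cases hq : q a <;> simp [hp, hq]

lemma freq_exists_le {κ : Type*} (s : Finset κ) (p : κ → α → Prop) :
    freq (fun a => ∃ i ∈ s, p i a) ≤ ∑ i ∈ s, freq (p i) := by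
  classical
  induction s using Finset.induction_on with
  | empty => simp [freq]
  | insert i s hi ih =>
    rw [Finset.sum_insert hi]
    refine le_trans (freq_mono fun a => ?_) ((freq_or_le (p i) _).trans (add_le_add le_rfl ih))
    simp

lemma freq_not [Nonempty α] (p : α → Prop) : freq (fun a => ¬ p a) = 1 - freq p := by
  rw [eq_sub_iff_add_eq]
  unfold freq
  rw [← Finset.expect_add_distrib]
  refine (Finset.expect_congr rfl fun a _ => ?_).trans (Fintype.expect_const (1 : ℝ))
  by_cases hp : p a <;> simp [hp]

lemma freq_comp_equiv (e : α ≃ β) (p : β → Prop) : freq (fun a => p (e a)) = freq p :=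
  Fintype.expect_equiv e _ _ fun _ => rfl

/-- Markov's inequality. -/
lemma freq_lt_le_expect_div {f : α → ℝ} (hf : ∀ a, 0 ≤ f a) {t : ℝ} (ht : 0 < t) :
    freq (fun a => t < f a) ≤ (𝔼 a, f a) / t := by
  unfold freq
  rw [Finset.expect_div]
  refine expect_mono' fun a => ?_
  split_ifs with h
  · rw [le_div_iff₀ ht]; linarith
  · exact div_nonneg (hf a) ht.le

lemma expect_abs_le_sqrt (f : α → ℝ) : 𝔼 a, |f a| ≤ √(𝔼 a, f a ^ 2) := by
  refine Real.le_sqrt_of_sq_le ?_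
  rcases isEmpty_or_nonempty α with h | h
  · simp [Finset.univ_eq_empty]
  have := Finset.expect_mul_sq_le_sq_mul_sq Finset.univ (fun a => |f a|) (fun _ => (1 : ℝ))
  simpa using this

lemma freq_prod_le {p : α × β → Prop} {c : ℝ} [Nonempty β]
    (h : ∀ b, freq (fun a => p (a, b)) ≤ c) : freq p ≤ c := by
  unfold freq at *
  rw [← Finset.univ_product_univ, Finset.expect_product, Finset.expect_comm]
  exact Finset.expect_le Finset.univ_nonempty fun b _ => h b

/-- Resampling one coordinate of a uniformly random function does not change its law. -/
lemma expect_expect_update {ι : Type*} [Fintype ι] [DecidableEq ι] [Nonempty α]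
    (i : ι) (f : (ι → α) → ℝ) : 𝔼 A, 𝔼 x, f (Function.update A i x) = 𝔼 A, f A := by
  classical
  -- Exchanging the fresh value with the old coordinate is an involution of the product space.
  let e : (ι → α) × α → (ι → α) × α := fun p => (Function.update p.1 i p.2, p.1 i)
  have he : Function.Involutive e := fun p => by simp [e]
  have h1 : 𝔼 A, 𝔼 x, f (Function.update A i x) = 𝔼 p : (ι → α) × α, f (e p).1 := by
    rw [← Finset.univ_product_univ, Finset.expect_product]
  have h2 : 𝔼 p : (ι → α) × α, f p.1 = 𝔼 A, f A := by
    rw [← Finset.univ_product_univ, Finset.expect_product]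
    simp
  rw [h1, ← h2]
  exact Fintype.expect_equiv he.toPerm _ _ fun p => rfl

/-- Conditioning: with the other coordinates frozen, only the randomness of coordinate `i` has to be
handled. -/
lemma expect_le_of_update {ι : Type*} [Fintype ι] [DecidableEq ι] [Nonempty α]
    (i : ι) (f : (ι → α) → ℝ) {c : ℝ} (h : ∀ A, 𝔼 x, f (Function.update A i x) ≤ c) :
    𝔼 A, f A ≤ c := by
  rw [← expect_expect_update i]
  exact Finset.expect_le Finset.univ_nonempty fun A _ => h A

lemma freq_le_of_update {ι : Type*} [Fintype ι] [DecidableEq ι] [Nonempty α]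
    (i : ι) (p : (ι → α) → Prop) {c : ℝ} (h : ∀ A, freq (fun x => p (Function.update A i x)) ≤ c) :
    freq p ≤ c := by
  classical
  exact expect_le_of_update i _ h

end UniformProbability

/-! ### Random sign vectors -/

section SignVectors

open scoped BigOperators

variable {ι : Type*} [DecidableEq ι]

/-- Reversal of one coordinate of a sign vector. -/
def flipSign (i : ι) : (ι → ℤˣ) ≃ (ι → ℤˣ) :=
  Function.Involutive.toPerm (fun x => Function.update x i (-x i)) fun x => by simp

lemma flipSign_apply (i : ι) (x : ι → ℤˣ) : flipSign i x = Function.update x i (-x i) := rfl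

lemma flipSign_same (i : ι) (x : ι → ℤˣ) : flipSign i x i = -x i := by simp [flipSign_apply]

lemma flipSign_of_ne {i l : ι} (h : l ≠ i) (x : ι → ℤˣ) : flipSign i x l = x l := by
  simp [flipSign_apply, h]

variable [Fintype ι]

/-- A sign as a real number. -/
def sgnR (u : ℤˣ) : ℝ := ((u : ℤ) : ℝ)

@[simp] lemma sgnR_neg (u : ℤˣ) : sgnR (-u) = -sgnR u := by simp [sgnR]

@[simp] lemma sgnR_mul_self (u : ℤˣ) : sgnR u * sgnR u = 1 := by
  rcases Int.units_eq_one_or u with rfl | rfl <;> simp [sgnR]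

@[simp] lemma abs_sgnR (u : ℤˣ) : |sgnR u| = 1 := by
  rcases Int.units_eq_one_or u with rfl | rfl <;> simp [sgnR]

lemma sgnR_injective : Function.Injective sgnR := fun u v h => by
  unfold sgnR at h
  exact Units.ext (by exact_mod_cast h)

lemma sum_mul_flipSign (i : ι) (v : ι → ℝ) (x : ι → ℤˣ) :
    ∑ l, v l * sgnR (flipSign i x l) = ∑ l, v l * sgnR (x l) - 2 * (v i * sgnR (x i)) := by
  rw [eq_sub_iff_add_eq, ← Finset.add_sum_erase _ _ (Finset.mem_univ i),
    ← Finset.add_sum_erase _ (fun l => v l * sgnR (x l)) (Finset.mem_univ i), flipSign_same,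
    Finset.sum_congr rfl fun l hl => by rw [flipSign_of_ne (Finset.ne_of_mem_erase hl)]]
  simp only [sgnR_neg]; ring

/-- If `p` implies the flip invariant `q` and is never invariant under the flip itself, then `p` has
at most half the probability of `q`. -/
lemma freq_le_half_of_flip {p q : (ι → ℤˣ) → Prop} (i : ι) (hpq : ∀ x, p x → q x)
    (hq : ∀ x, q (flipSign i x) → q x) (hp : ∀ x, p x → ¬ p (flipSign i x)) :
    freq p ≤ freq q / 2 := by
  have h1 : freq (fun x => p (flipSign i x)) = freq p := freq_comp_equiv (flipSign i) p
  have h2 : freq p + freq (fun x => p (flipSign i x)) ≤ freq q := by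
    unfold freq
    rw [← Finset.expect_add_distrib]
    refine expect_mono' fun x => ?_
    by_cases ha : p x
    · simp [ha, hp x ha, hpq x ha]
    · by_cases hb : p (flipSign i x)
      · simp [ha, hb, hq x (hpq _ hb)]
      · simp only [ha, hb, if_false]; split_ifs <;> norm_num
  linarith

lemma expect_eq_zero_of_flip (i : ι) (f : (ι → ℤˣ) → ℝ) (h : ∀ x, f (flipSign i x) = -f x) :
    𝔼 x, f x = 0 := by
  have h1 : 𝔼 x, f (flipSign i x) = 𝔼 x, f x := Fintype.expect_equiv (flipSign i) _ _ fun _ => rfl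
  simp only [h, Finset.expect_neg_distrib] at h1
  linarith

/-- Flipping `x i` moves the sum by `2 * |v i| > 2 * c`, so `x` and its flip cannot both satisfy the
bound. -/
lemma freq_abs_sum_le_half (v : ι → ℝ) {c : ℝ} {i : ι} (hi : c < |v i|) :
    freq (fun x : ι → ℤˣ => |∑ l, v l * sgnR (x l)| ≤ c) ≤ 1 / 2 := by
  refine (freq_le_half_of_flip (q := fun _ => True) i (by simp) (by simp) fun x hx h => ?_).trans
    (by linarith [freq_le_one (fun _ : ι → ℤˣ => True)])
  rw [sum_mul_flipSign] at h
  have h2 : |v i * sgnR (x i)| = |v i| := by rw [abs_mul, abs_sgnR, mul_one]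
  rw [← h2] at hi
  rw [abs_le] at hx h
  rcases lt_abs.1 hi with h3 | h3 <;> linarith

end SignVectors

/-! ### Quadratic forms in random signs -/

section QuadraticForms

open scoped BigOperators

/-- A sign vector as a vector of Euclidean space. -/
noncomputable def signVec {ι : Type*} (x : ι → ℤˣ) : EuclideanSpace ℝ ι :=
  WithLp.toLp 2 fun i => sgnR (x i)

@[simp] lemma signVec_apply {ι : Type*} (x : ι → ℤˣ) (i : ι) : signVec x i = sgnR (x i) := rfl

section

variable {ι : Type*} [Fintype ι]

lemma inner_signVec (u : EuclideanSpace ℝ ι) (x : ι → ℤˣ) :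
    inner ℝ u (signVec x) = ∑ l, u l * sgnR (x l) := by
  simp [PiLp.inner_apply, mul_comm]

lemma sq_norm_starProjection_eq_sum (U : Submodule ℝ (EuclideanSpace ℝ ι))
    (v : EuclideanSpace ℝ ι) : ‖U.starProjection v‖ ^ 2 =
      ∑ a, inner ℝ (stdOrthonormalBasis ℝ U a : EuclideanSpace ℝ ι) v ^ 2 := by
  rw [Submodule.starProjection_apply, ← Submodule.coe_norm,
    ← (stdOrthonormalBasis ℝ U).sum_sq_norm_inner_right]
  refine Finset.sum_congr rfl fun a _ => ?_
  rw [Submodule.inner_orthogonalProjectionOnto_eq_of_mem_left, Real.norm_eq_abs, sq_abs]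

end

variable {ι : Type*} [DecidableEq ι] [Fintype ι]

lemma expect_sq_sum_sign (c : ι → ℝ) (S : Finset ι) :
    𝔼 x : ι → ℤˣ, (∑ l ∈ S, c l * sgnR (x l)) ^ 2 = ∑ l ∈ S, c l ^ 2 := by
  induction S using Finset.induction_on with
  | empty => simp
  | insert a S ha ih =>
    have h0 : 𝔼 x : ι → ℤˣ, sgnR (x a) * (2 * c a * ∑ l ∈ S, c l * sgnR (x l)) = 0 := by
      refine expect_eq_zero_of_flip a _ fun x => ?_
      rw [flipSign_same, sgnR_neg, Finset.sum_congr rfl fun l hl => by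
        rw [flipSign_of_ne (ne_of_mem_of_not_mem hl ha)]]
      ring
    rw [Finset.sum_insert ha, ← ih, ← add_zero (c a ^ 2), ← h0,
      ← Fintype.expect_const (ι := ι → ℤˣ) (c a ^ 2), ← Finset.expect_add_distrib,
      ← Finset.expect_add_distrib]
    refine Finset.expect_congr rfl fun x _ => ?_
    rw [Finset.sum_insert ha]
    linear_combination c a ^ 2 * sgnR_mul_self (x a)

/-- The diagonal part is deterministic because signs square to `1`. A new index `a` adds `2 * x a *
∑ p a l * x l`, whose cross term with the earlier form is odd in `x a`; only its own second moment
survives. -/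
lemma expect_sq_quadraticForm_le (p : ι → ι → ℝ) (hp : ∀ i l, p i l = p l i) (S : Finset ι) :
    𝔼 x : ι → ℤˣ, (∑ i ∈ S, ∑ l ∈ S, p i l * (sgnR (x i) * sgnR (x l)) - ∑ i ∈ S, p i i) ^ 2 ≤
      2 * ∑ i ∈ S, ∑ l ∈ S, p i l ^ 2 := by
  induction S using Finset.induction_on with
  | empty => simp
  | insert a S ha ih =>
    have h0 : 𝔼 x : ι → ℤˣ, sgnR (x a) * (4 * (∑ l ∈ S, p a l * sgnR (x l)) *
        (∑ i ∈ S, ∑ l ∈ S, p i l * (sgnR (x i) * sgnR (x l)) - ∑ i ∈ S, p i i)) = 0 := by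
      refine expect_eq_zero_of_flip a _ fun x => ?_
      have hx : ∀ l ∈ S, flipSign a x l = x l := fun l hl =>
        flipSign_of_ne (ne_of_mem_of_not_mem hl ha) x
      rw [flipSign_same, sgnR_neg, Finset.sum_congr rfl fun l hl => by rw [hx l hl],
        Finset.sum_congr rfl fun i hi => Finset.sum_congr rfl fun l hl => by rw [hx i hi, hx l hl]]
      ring
    have h1 : 𝔼 x : ι → ℤˣ, (∑ i ∈ insert a S, ∑ l ∈ insert a S,
        p i l * (sgnR (x i) * sgnR (x l)) - ∑ i ∈ insert a S, p i i) ^ 2 =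
        𝔼 x : ι → ℤˣ, (∑ i ∈ S, ∑ l ∈ S, p i l * (sgnR (x i) * sgnR (x l)) - ∑ i ∈ S, p i i) ^ 2
          + 4 * ∑ l ∈ S, p a l ^ 2 := by
      rw [← expect_sq_sum_sign, Finset.mul_expect, ← Finset.expect_add_distrib]
      refine Eq.trans ?_ (add_zero _)
      rw [← h0, ← Finset.expect_add_distrib]
      refine Finset.expect_congr rfl fun x _ => ?_
      have e1 : ∑ i ∈ insert a S, ∑ l ∈ insert a S, p i l * (sgnR (x i) * sgnR (x l)) =
          p a a * (sgnR (x a) * sgnR (x a)) + 2 * (sgnR (x a) * ∑ l ∈ S, p a l * sgnR (x l)) +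
          ∑ i ∈ S, ∑ l ∈ S, p i l * (sgnR (x i) * sgnR (x l)) := by
        simp only [Finset.sum_insert ha, Finset.sum_add_distrib]
        rw [Finset.sum_congr rfl fun i _ => show p i a * (sgnR (x i) * sgnR (x a)) =
            sgnR (x a) * (p a i * sgnR (x i)) by rw [hp i a]; ring,
          Finset.sum_congr rfl fun i _ => show p a i * (sgnR (x a) * sgnR (x i)) =
            sgnR (x a) * (p a i * sgnR (x i)) by ring, ← Finset.mul_sum]
        ring
      rw [e1, Finset.sum_insert ha, sgnR_mul_self]
      linear_combination 4 * (∑ l ∈ S, p a l * sgnR (x l)) ^ 2 * sgnR_mul_self (x a)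
    rw [h1]
    have e2 : ∑ i ∈ insert a S, ∑ l ∈ insert a S, p i l ^ 2 =
        p a a ^ 2 + 2 * ∑ l ∈ S, p a l ^ 2 + ∑ i ∈ S, ∑ l ∈ S, p i l ^ 2 := by
      simp only [Finset.sum_insert ha, Finset.sum_add_distrib]
      rw [Finset.sum_congr rfl fun i _ => show p i a ^ 2 = p a i ^ 2 by rw [hp i a]]
      ring
    rw [e2]
    nlinarith [sq_nonneg (p a a)]

/-- The squared length of the projection of a random sign vector to an `r`-dimensional space has
mean `r` and variance at most `2 r`. -/
lemma expect_sq_norm_starProjection_sub_le (U : Submodule ℝ (EuclideanSpace ℝ ι)) :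
    𝔼 x : ι → ℤˣ, (‖U.starProjection (signVec x)‖ ^ 2 - Module.finrank ℝ U) ^ 2 ≤
      2 * Module.finrank ℝ U := by
  set b := stdOrthonormalBasis ℝ U
  -- This is the matrix of the projection onto `U`: its trace and its squared Hilbert–Schmidt norm
  -- both equal the dimension.
  let p : ι → ι → ℝ := fun i l => ∑ a, (b a : EuclideanSpace ℝ ι) i * (b a : EuclideanSpace ℝ ι) l
  have hin : ∀ a c, ∑ i, (b a : EuclideanSpace ℝ ι) i * (b c : EuclideanSpace ℝ ι) i =
      if a = c then 1 else 0 := fun a c => by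
    rw [← orthonormal_iff_ite.1 b.orthonormal a c, Submodule.coe_inner, PiLp.inner_apply]
    simp [mul_comm]
  have htr : ∑ i, p i i = Module.finrank ℝ U := by
    rw [Finset.sum_comm]
    simp [hin]
  have hsq : ∑ i, ∑ l, p i l ^ 2 = Module.finrank ℝ U := by
    have : ∀ i l, p i l ^ 2 = ∑ a, ∑ c,
        ((b a : EuclideanSpace ℝ ι) i * (b c : EuclideanSpace ℝ ι) i) *
        ((b a : EuclideanSpace ℝ ι) l * (b c : EuclideanSpace ℝ ι) l) := fun i l => by
      rw [sq, Finset.sum_mul_sum]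
      exact Finset.sum_congr rfl fun a _ => Finset.sum_congr rfl fun c _ => by ring
    calc ∑ i, ∑ l, p i l ^ 2
        = ∑ a, ∑ c, (∑ i, (b a : EuclideanSpace ℝ ι) i * (b c : EuclideanSpace ℝ ι) i) *
          ∑ l, (b a : EuclideanSpace ℝ ι) l * (b c : EuclideanSpace ℝ ι) l := by
          simp only [this, Finset.sum_mul_sum]
          rw [Finset.sum_congr rfl fun i _ => Finset.sum_comm, Finset.sum_comm]
          refine Finset.sum_congr rfl fun a _ => ?_
          rw [Finset.sum_congr rfl fun i _ => Finset.sum_comm, Finset.sum_comm]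
      _ = _ := by simp [hin]
  have hq : ∀ x : ι → ℤˣ, ‖U.starProjection (signVec x)‖ ^ 2 =
      ∑ i, ∑ l, p i l * (sgnR (x i) * sgnR (x l)) := fun x => by
    rw [sq_norm_starProjection_eq_sum]
    simp only [inner_signVec, p, Finset.sum_mul]
    rw [Finset.sum_congr rfl fun i _ => Finset.sum_comm, Finset.sum_comm]
    refine Finset.sum_congr rfl fun a _ => ?_
    rw [sq, Finset.sum_mul_sum]
    exact Finset.sum_congr rfl fun a _ => Finset.sum_congr rfl fun c _ => by ring
  have := expect_sq_quadraticForm_le p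
    (fun i l => Finset.sum_congr rfl fun a _ => mul_comm _ _) Finset.univ
  rw [htr, hsq] at this
  simpa only [hq] using this

end QuadraticForms

/-! ### Small ball estimates -/

section SmallBall

variable {ι : Type*} [Fintype ι]

lemma exists_sup_normalized {U : Submodule ℝ (EuclideanSpace ℝ ι)} {u : EuclideanSpace ℝ ι}
    (hu : u ∈ U) (h0 : u ≠ 0) : ∃ v ∈ U, (∀ i, |v i| ≤ 1) ∧ ∃ i, v i = 1 := by
  have : Nonempty ι := by
    by_contra h
    rw [not_nonempty_iff] at h
    exact h0 (Subsingleton.elim _ _)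
  obtain ⟨i, hi⟩ := Finite.exists_max fun i => |u i|
  have hui : u i ≠ 0 := fun h => h0 (by
    ext l
    have := hi l
    rw [h, abs_zero] at this
    exact abs_eq_zero.1 (le_antisymm this (abs_nonneg _)))
  refine ⟨(u i)⁻¹ • u, U.smul_mem _ hu, fun l => ?_, i, by simp [hui]⟩
  rw [PiLp.smul_apply, smul_eq_mul, abs_mul, abs_inv, inv_mul_le_iff₀ (abs_pos.2 hui), mul_one]
  exact hi l

variable [DecidableEq ι]

/-- A robust form of Odlyzko's lemma: a random sign vector is almost orthogonal to all the
bounded vectors of an `r`-dimensional space with probability at most `2 ^ (-r)`. -/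
lemma freq_forall_abs_sum_lt_one_le (r : ℕ) : ∀ U : Submodule ℝ (EuclideanSpace ℝ ι),
    r ≤ Module.finrank ℝ U → freq (fun x : ι → ℤˣ =>
      ∀ u ∈ U, (∀ i, |u i| ≤ 1) → |∑ l, u l * sgnR (x l)| < 1) ≤ (1 / 2) ^ r := by
  induction r with
  | zero => intro U _; simpa using freq_le_one _
  | succ r ih =>
    intro U hr
    have hU : U ≠ ⊥ := by rintro rfl; simp at hr
    obtain ⟨u, huU, hu0⟩ := U.exists_mem_ne_zero_of_ne_bot hU
    obtain ⟨v, hvU, hv, i, hi⟩ := exists_sup_normalized huU hu0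
    let f : U →ₗ[ℝ] ℝ := (EuclideanSpace.proj (𝕜 := ℝ) i).toLinearMap.comp U.subtype
    have hf : ∀ w : U, f w = (w : EuclideanSpace ℝ ι) i := fun w => rfl
    -- For vectors of `U` vanishing at `i` the condition ignores the flip of `x i`, while for `v`
    -- the flip moves the sum by exactly `2`, out of `(-1, 1)`. Each dimension thus gains a factor
    -- `1 / 2`.
    let U' : Submodule ℝ (EuclideanSpace ℝ ι) := (LinearMap.ker f).map U.subtype
    have hU' : ∀ w, w ∈ U' ↔ w ∈ U ∧ w i = 0 := fun w => by
      simp only [U', Submodule.mem_map, LinearMap.mem_ker, hf, Submodule.subtype_apply]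
      constructor
      · rintro ⟨y, hy, rfl⟩; exact ⟨y.2, hy⟩
      · rintro ⟨h1, h2⟩; exact ⟨⟨w, h1⟩, h2, rfl⟩
    have hr' : r ≤ Module.finrank ℝ U' := by
      have h1 := f.finrank_range_add_finrank_ker
      have h2 : Module.finrank ℝ (LinearMap.range f) ≤ 1 :=
        (Submodule.finrank_le _).trans (by simp)
      have h3 : Module.finrank ℝ U' = Module.finrank ℝ (LinearMap.ker f) :=
        Submodule.finrank_map_subtype_eq _ _
      omega
    refine (freq_le_half_of_flip i (q := fun x => ∀ u ∈ U', (∀ i, |u i| ≤ 1) →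
      |∑ l, u l * sgnR (x l)| < 1) (fun x hx u hu => hx u ((hU' u).1 hu).1) (fun x hx u hu h => ?_)
      fun x hx h => ?_).trans ?_
    · have := hx u hu h
      rwa [sum_mul_flipSign, ((hU' u).1 hu).2, zero_mul, mul_zero, sub_zero] at this
    · have h1 := hx v hvU hv
      have h2 := h v hvU hv
      rw [sum_mul_flipSign, hi, one_mul] at h2
      rw [abs_lt] at h1 h2
      have h3 := abs_sgnR (x i)
      rcases abs_choice (sgnR (x i)) with h4 | h4 <;> rw [h4] at h3 <;> linarith
    · rw [pow_succ]
      linarith [ih U' hr']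

/-- The Littlewood-Offord inequality of Erdős, when all the coefficients are large. -/
lemma freq_abs_add_sum_lt_le (w : ι → ℝ) {δ : ℝ} (hδ : 0 < δ) (hw : ∀ i, δ ≤ |w i|) (c : ℝ) :
    freq (fun z : ι → ℤˣ => |c + ∑ i, w i * sgnR (z i)| < δ) ≤
      ((Fintype.card ι).choose (Fintype.card ι / 2) : ℝ) / 2 ^ Fintype.card ι := by
  classical
  rw [freq_eq_card_div]
  have hcard : (Fintype.card (ι → ℤˣ) : ℝ) = 2 ^ Fintype.card ι := by simp
  rw [hcard]
  gcongr
  let F : (ι → ℤˣ) → Finset ι := fun z => Finset.univ.filter fun i => 0 < w i * sgnR (z i)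
  have hval : ∀ z i, w i * sgnR (z i) = if i ∈ F z then |w i| else -|w i| := fun z i => by
    have h1 : |w i * sgnR (z i)| = |w i| := by rw [abs_mul, abs_sgnR, mul_one]
    simp only [F, Finset.mem_filter, Finset.mem_univ, true_and]
    split_ifs with h
    · rw [← h1, abs_of_pos h]
    · rw [← h1, abs_of_nonpos (not_lt.1 h), neg_neg]
  have hinj : Function.Injective F := fun z z' h => by
    funext i
    have h1 : w i * sgnR (z i) = w i * sgnR (z' i) := by rw [hval, hval, h]
    exact sgnR_injective (mul_left_cancel₀ (abs_pos.1 (hδ.trans_le (hw i))) h1)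
  rw [← Finset.card_image_of_injective _ hinj]
  -- The sets of positive terms form an antichain: strictly enlarging such a set raises the sum by
  -- at least `2 * δ`, more than the open window allows.
  refine IsAntichain.sperner ?_
  intro A hA B hB hne hsub
  simp only [Finset.coe_image, Finset.coe_filter, Finset.mem_univ, true_and, Set.mem_image,
    Set.mem_ofPred_eq] at hA hB
  obtain ⟨z, hz, rfl⟩ := hA
  obtain ⟨z', hz', rfl⟩ := hB
  obtain ⟨j, hj', hj⟩ := Finset.exists_of_ssubset (hsub.ssubset_of_ne hne)
  have h1 : ∑ i, w i * sgnR (z i) + 2 * δ ≤ ∑ i, w i * sgnR (z' i) := by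
    rw [← Finset.add_sum_erase _ _ (Finset.mem_univ j),
      ← Finset.add_sum_erase _ (fun i => w i * sgnR (z' i)) (Finset.mem_univ j)]
    have h2 : w j * sgnR (z j) + 2 * δ ≤ w j * sgnR (z' j) := by
      rw [hval z, hval z', if_neg hj, if_pos hj']
      linarith [hw j]
    have h3 : ∑ i ∈ Finset.univ.erase j, w i * sgnR (z i) ≤
        ∑ i ∈ Finset.univ.erase j, w i * sgnR (z' i) := by
      refine Finset.sum_le_sum fun i _ => ?_
      rw [hval z, hval z']
      by_cases h : i ∈ F z
      · rw [if_pos h, if_pos (hsub h)]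
      · rw [if_neg h]
        split_ifs
        · linarith [abs_nonneg (w i)]
        · exact le_rfl
    linarith
  rw [abs_lt] at hz hz'
  linarith

/-- The Littlewood-Offord inequality of Erdős. -/
lemma freq_abs_sum_lt_le (v : ι → ℝ) {δ : ℝ} (hδ : 0 < δ) (T : Finset ι)
    (hT : ∀ i ∈ T, δ ≤ |v i|) : freq (fun x : ι → ℤˣ => |∑ i, v i * sgnR (x i)| < δ) ≤
      (T.card.choose (T.card / 2) : ℝ) / 2 ^ T.card := by
  -- The signs outside `T` are frozen and only shift the sum by a constant.
  let e := Equiv.piEquivPiSubtypeProd (fun i => i ∈ T) fun _ => ℤˣ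
  rw [← freq_comp_equiv e.symm]
  refine freq_prod_le fun b => ?_
  have h := freq_abs_add_sum_lt_le (fun i : {i // i ∈ T} => v i) hδ (fun i => hT i i.2)
    (∑ i : {i // i ∉ T}, v i * sgnR (b i))
  rw [Fintype.card_coe] at h
  refine (freq_congr fun a => ?_).trans_le h
  rw [← Fintype.sum_subtype_add_sum_subtype (fun i => i ∈ T), add_comm]
  have h1 : ∀ i : {i // i ∈ T}, e.symm (a, b) i = a i := fun i => by
    simp [e, Equiv.piEquivPiSubtypeProd]
  have h2 : ∀ i : {i // i ∉ T}, e.symm (a, b) i = b i := fun i => by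
    simp [e, Equiv.piEquivPiSubtypeProd, i.2]
  simp only [h1, h2]
  congr!

/-- The induction rests on `(2 * l + 1) * (2 * l + 3) ≤ (2 * l + 2) ^ 2`. -/
lemma sq_centralBinom_mul_le (l : ℕ) : l.centralBinom ^ 2 * (2 * l + 1) ≤ 16 ^ l := by
  induction l with
  | zero => simp
  | succ l ih =>
    have h := Nat.succ_mul_centralBinom_succ l
    have h1 : (l + 1) ^ 2 * ((l + 1).centralBinom ^ 2 * (2 * (l + 1) + 1)) ≤
        (l + 1) ^ 2 * 16 ^ (l + 1) := by
      calc (l + 1) ^ 2 * ((l + 1).centralBinom ^ 2 * (2 * (l + 1) + 1))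
          = ((l + 1) * (l + 1).centralBinom) ^ 2 * (2 * (l + 1) + 1) := by ring
        _ = (l.centralBinom ^ 2 * (2 * l + 1)) * (4 * ((2 * l + 1) * (2 * l + 3))) := by
          rw [h]; ring
        _ ≤ 16 ^ l * (4 * (4 * (l + 1) ^ 2)) := by
          exact Nat.mul_le_mul ih (Nat.mul_le_mul_left 4 (by nlinarith))
        _ = _ := by ring
    exact Nat.le_of_mul_le_mul_left h1 (by positivity)

lemma centralBinom_div_le (l : ℕ) : (l.centralBinom : ℝ) / 4 ^ l ≤ 1 / √(2 * l + 1) := by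
  rw [div_le_div_iff₀ (by positivity) (by positivity), one_mul]
  refine abs_le_of_sq_le_sq' ?_ (by positivity) |>.2
  rw [mul_pow, Real.sq_sqrt (by positivity), ← pow_mul, mul_comm l 2, pow_mul]
  have := sq_centralBinom_mul_le l
  norm_num
  exact_mod_cast this

end SmallBall

/-! ### Projections of random sign vectors -/

section Projections

variable {ι : Type*} [Fintype ι]

/-- Cauchy–Schwarz with `‖u‖ ^ 2 ≤ card ι`: one test vector with a non-small inner product already
keeps the projection from being small. -/
lemma sq_sum_mul_sgnR_le {U : Submodule ℝ (EuclideanSpace ℝ ι)} {u : EuclideanSpace ℝ ι}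
    (hu : u ∈ U) (h1 : ∀ i, |u i| ≤ 1) (x : ι → ℤˣ) :
    (∑ l, u l * sgnR (x l)) ^ 2 ≤ ‖U.starProjection (signVec x)‖ ^ 2 * Fintype.card ι := by
  have h2 : ∑ l, u l * sgnR (x l) = inner ℝ u (U.starProjection (signVec x)) := by
    rw [← inner_signVec, ← Submodule.inner_starProjection_left_eq_right,
      Submodule.starProjection_eq_self_iff.2 hu]
  have h3 : ‖u‖ ^ 2 ≤ Fintype.card ι := by
    rw [EuclideanSpace.norm_sq_eq]
    refine (Finset.sum_le_card_nsmul _ _ 1 fun i _ => ?_).trans (by simp)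
    rw [Real.norm_eq_abs]
    exact pow_le_one₀ (abs_nonneg _) (h1 i)
  rw [h2, ← sq_abs]
  calc |inner ℝ u (U.starProjection (signVec x))| ^ 2
      ≤ (‖u‖ * ‖U.starProjection (signVec x)‖) ^ 2 := by
        gcongr
        exact abs_real_inner_le_norm _ _
    _ = ‖U.starProjection (signVec x)‖ ^ 2 * ‖u‖ ^ 2 := by ring
    _ ≤ _ := by gcongr

variable [DecidableEq ι]

lemma freq_sq_norm_starProjection_lt_le (U : Submodule ℝ (EuclideanSpace ℝ ι)) {r : ℕ}
    (hr : r ≤ Module.finrank ℝ U) :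
    freq (fun x : ι → ℤˣ => ‖U.starProjection (signVec x)‖ ^ 2 * Fintype.card ι < 1) ≤
      (1 / 2) ^ r := by
  refine (freq_mono fun x hx u hu h1 => ?_).trans (freq_forall_abs_sum_lt_one_le r U hr)
  rw [← sq_lt_one_iff_abs_lt_one]
  exact (sq_sum_mul_sgnR_le hu h1 x).trans_lt hx

lemma freq_sq_norm_starProjection_lt_le_centralBinom {U : Submodule ℝ (EuclideanSpace ℝ ι)}
    {u : EuclideanSpace ℝ ι} (hu : u ∈ U) (h1 : ∀ i, |u i| ≤ 1) {N : ℝ} (hN : 0 < N) {l : ℕ}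
    (hl : 2 * l ≤ (Finset.univ.filter fun i => 1 ≤ N * |u i|).card) :
    freq (fun x : ι → ℤˣ => ‖U.starProjection (signVec x)‖ ^ 2 * Fintype.card ι * N ^ 2 < 1) ≤
      (l.centralBinom : ℝ) / 4 ^ l := by
  obtain ⟨T, hT, hTl⟩ := Finset.exists_subset_card_eq hl
  have h2 := freq_abs_sum_lt_le u (inv_pos.2 hN) T fun i hi => by
    rw [inv_le_iff_one_le_mul₀ hN, mul_comm]
    exact (Finset.mem_filter.1 (hT hi)).2
  have h3 : (4 : ℝ) ^ l = 2 ^ (2 * l) := by rw [pow_mul]; norm_num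
  rw [hTl, Nat.mul_div_cancel_left l two_pos, ← Nat.centralBinom_eq_two_mul_choose, ← h3] at h2
  refine (freq_mono fun x hx => ?_).trans h2
  refine abs_lt_of_sq_lt_sq ?_ (inv_nonneg.2 hN.le)
  refine (sq_sum_mul_sgnR_le hu h1 x).trans_lt ?_
  rw [inv_pow, ← one_div, lt_div_iff₀ (by positivity)]
  exact hx

end Projections

/-! ### Normal vectors of random sign vectors are spread out -/

section Spread

open scoped BigOperators

open Classical in
/-- The vector supported on the range of `p.1` whose values there are given by `p.2`. -/
noncomputable def sparseVector {ι : Type*} {m : ℕ} {Z : Finset ℤ}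
    (p : (Fin m → ι) × (Fin m → Z)) (i : ι) : ℤ :=
  if h : ∃ l, p.1 l = i then p.2 h.choose else 0

/-- Lists of positions and values encode all sparse vectors, which bounds their number in the union
bound. -/
lemma exists_sparseVector_eq {ι : Type*} [Nonempty ι] {m : ℕ} {Z : Finset ℤ} (w : ι → ℤ)
    (S : Finset ι) (hS : S.card ≤ m) (h0 : ∀ i ∉ S, w i = 0) (hZ : ∀ i, w i ∈ Z) :
    ∃ p : (Fin m → ι) × (Fin m → Z), sparseVector p = w := by
  -- Padding and repetitions are harmless, since the value recorded at a position is always that of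
  -- `w`.
  let e : Fin m → ι := fun l => S.toList.getD l (Classical.arbitrary ι)
  refine ⟨(e, fun l => ⟨w (e l), hZ _⟩), ?_⟩
  funext i
  unfold sparseVector
  split_ifs with h
  · exact congrArg w h.choose_spec
  · refine (h0 i fun hi => h ?_).symm
    obtain ⟨l, hl, hli⟩ := List.mem_iff_getElem.1 (Finset.mem_toList.2 hi)
    refine ⟨⟨l, (hl.trans_eq (Finset.length_toList S)).trans_le hS⟩, ?_⟩
    simp only [e]
    rw [List.getD_eq_getElem _ _ hl, hli]

variable {ι κ : Type*} [DecidableEq ι] [Fintype ι] [DecidableEq κ] [Fintype κ]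

/-- The rows are independent: resampling them one at a time yields a factor `1 / 2` each. -/
lemma freq_forall_abs_sum_le_le (R : Finset κ) (w : ι → ℝ) {c : ℝ} {i : ι} (hi : c < |w i|) :
    freq (fun A : κ → ι → ℤˣ => ∀ r ∈ R, |∑ l, w l * sgnR (A r l)| ≤ c) ≤ (1 / 2) ^ R.card := by
  induction R using Finset.induction_on with
  | empty => simpa using freq_le_one _
  | insert a R ha ih =>
    rw [Finset.card_insert_of_notMem ha, pow_succ]
    refine le_trans ?_ (mul_le_mul_of_nonneg_right ih (by norm_num))
    unfold freq
    rw [← expect_expect_update a, Finset.expect_mul]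
    refine expect_mono' fun A => ?_
    have h1 : ∀ x : ι → ℤˣ, (∀ r ∈ insert a R, |∑ l, w l * sgnR (Function.update A a x r l)| ≤ c) ↔
        (|∑ l, w l * sgnR (x l)| ≤ c ∧ ∀ r ∈ R, |∑ l, w l * sgnR (A r l)| ≤ c) := fun x => by
      rw [Finset.forall_mem_insert, Function.update_self]
      refine and_congr_right fun _ => forall₂_congr fun r hr => ?_
      rw [Function.update_of_ne (ne_of_mem_of_not_mem hr ha)]
    change freq (fun x : ι → ℤˣ => ∀ r ∈ insert a R,
      |∑ l, w l * sgnR (Function.update A a x r l)| ≤ c) ≤ _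
    rw [freq_congr h1]
    by_cases h : ∀ r ∈ R, |∑ l, w l * sgnR (A r l)| ≤ c
    · rw [if_pos h, one_mul]
      exact (freq_mono fun x hx => hx.1).trans (freq_abs_sum_le_half w hi)
    · rw [if_neg h, zero_mul]
      refine (freq_mono (q := fun _ => False) fun x hx => h hx.2).trans ?_
      simp [freq]

/-- With high probability, all the vectors orthogonal to given rows of a random sign matrix have
many coordinates that are not too small. -/
lemma freq_exists_concentrated_normal_le (R : Finset κ) (m : ℕ) :
    freq (fun A : κ → ι → ℤˣ => ∃ v : ι → ℝ, (∀ i, |v i| ≤ 1) ∧ (∃ i, v i = 1) ∧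
      (Finset.univ.filter fun i => 1 ≤ ((Fintype.card ι : ℝ) + 1) * |v i|).card ≤ m ∧
      ∀ r ∈ R, ∑ l, v l * sgnR (A r l) = 0) ≤
    ((Fintype.card ι : ℝ) * (2 * Fintype.card ι + 3)) ^ m * (1 / 2) ^ R.card := by
  set n := Fintype.card ι with hn
  let Z : Finset ℤ := Finset.Icc (-(n + 1)) (n + 1)
  let G := (Fin m → ι) × (Fin m → Z)
  refine le_trans (freq_mono (q := fun A => ∃ g ∈ (Finset.univ : Finset G),
    (∀ r ∈ R, |∑ l, (sparseVector g l : ℝ) * sgnR (A r l)| ≤ n) ∧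
      ∃ i, (n : ℝ) < |(sparseVector g i : ℝ)|) ?_) ((freq_exists_le _ _).trans ?_)
  · rintro A ⟨v, hv, ⟨i, hi⟩, hm, hA⟩
    have : Nonempty ι := ⟨i⟩
    -- Round `(n + 1) * v` to integers, dropping the small coordinates. The error is at most `1` per
    -- coordinate, so every sum stays within `n`, while the coordinate with `v i = 1` becomes `n + 1
    -- > n`. A union bound over sparse integer vectors then applies.
    let w : ι → ℤ := fun l => if 1 ≤ ((n : ℝ) + 1) * |v l| then ⌊((n : ℝ) + 1) * v l⌋ else 0
    obtain ⟨g, hg⟩ := exists_sparseVector_eq (m := m) (Z := Z) w _ hm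
      (fun l hl => if_neg fun h => hl (Finset.mem_filter.2 ⟨Finset.mem_univ l, h⟩)) (fun l => by
        have h1 := abs_le.1 (hv l)
        have hn0 : (0 : ℝ) ≤ n := Nat.cast_nonneg _
        simp only [w, Z, Finset.mem_Icc]
        split_ifs
        · constructor
          · rw [Int.le_floor]; push_cast; nlinarith
          · have := Int.floor_le (((n : ℝ) + 1) * v l)
            have h2 : ((⌊((n : ℝ) + 1) * v l⌋ : ℤ) : ℝ) ≤ ((n + 1 : ℤ) : ℝ) := by
              push_cast; nlinarith
            exact_mod_cast h2
        · constructor <;> omega)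
    refine ⟨g, Finset.mem_univ _, fun r hr => ?_, i, ?_⟩
    · rw [hg]
      have h1 : ∑ l, (w l : ℝ) * sgnR (A r l) =
          ∑ l, ((w l : ℝ) - ((n : ℝ) + 1) * v l) * sgnR (A r l) := by
        have := congrArg (((n : ℝ) + 1) * ·) (hA r hr)
        simp only [Finset.mul_sum, mul_zero] at this
        rw [← sub_zero (∑ l, (w l : ℝ) * sgnR (A r l)), ← this, ← Finset.sum_sub_distrib]
        exact Finset.sum_congr rfl fun l _ => by ring
      rw [h1]
      refine (Finset.abs_sum_le_sum_abs _ _).trans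
        ((Finset.sum_le_card_nsmul _ _ 1 fun l _ => ?_).trans (by simp [hn]))
      rw [abs_mul, abs_sgnR, mul_one, abs_le]
      simp only [w]
      split_ifs with h
      · have := Int.floor_le (((n : ℝ) + 1) * v l)
        have := Int.lt_floor_add_one (((n : ℝ) + 1) * v l)
        constructor <;> linarith
      · have h3 : |((n : ℝ) + 1) * v l| < 1 := by
          rw [abs_mul, abs_of_nonneg (by positivity)]
          exact not_le.1 h
        rw [abs_lt] at h3
        push_cast
        constructor <;> linarith
    · have h1 : w i = n + 1 := by
        have h2 : (1 : ℝ) ≤ (n : ℝ) + 1 := by linarith [(Nat.cast_nonneg n : (0 : ℝ) ≤ n)]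
        have h3 : ((n : ℝ) + 1) = ((n + 1 : ℤ) : ℝ) := by push_cast; rfl
        simp only [w, hi, abs_one, mul_one, h2, if_true]
        rw [h3, Int.floor_intCast]
      rw [hg, h1]
      push_cast
      rw [abs_of_nonneg (by positivity)]
      linarith
  · have hcard : ((Finset.univ : Finset G).card : ℝ) = ((n : ℝ) * (2 * n + 3)) ^ m := by
      have hZ : Z.card = 2 * n + 3 := by simp only [Z, Int.card_Icc]; omega
      simp [G, hZ, mul_pow, ← hn]
    rw [← hcard, ← nsmul_eq_mul]
    refine Finset.sum_le_card_nsmul _ _ _ fun g _ => ?_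
    by_cases h : ∃ i, (n : ℝ) < |(sparseVector g i : ℝ)|
    · obtain ⟨i, hi⟩ := h
      exact (freq_mono fun A hA => hA.1).trans
        (freq_forall_abs_sum_le_le R (fun l => (sparseVector g l : ℝ)) hi)
    · refine le_trans (freq_mono (q := fun _ => False) fun A hA => h hA.2) ?_
      simp [freq]

end Spread

/-! ### The determinant as a volume -/

section Volume

variable {n : ℕ}

/-- The determinant of a matrix of signs. -/
noncomputable def signDet (A : Fin n → Fin n → ℤˣ) : ℝ :=
  (Matrix.of fun i j => sgnR (A i j)).det

/-- The span of the rows of a sign matrix that precede a given one. -/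
noncomputable def prevSpan (A : Fin n → Fin n → ℤˣ) (d : Fin n) :
    Submodule ℝ (EuclideanSpace ℝ (Fin n)) :=
  Submodule.span ℝ ((fun r => signVec (A r)) '' Set.Iio d)

/-- The squared distance of a row of a sign matrix to the span of the preceding ones. -/
noncomputable def sqDist (A : Fin n → Fin n → ℤˣ) (d : Fin n) : ℝ :=
  ‖(prevSpan A d)ᗮ.starProjection (signVec (A d))‖ ^ 2

/-- The codimension of the span of the rows preceding a given one. -/
noncomputable def prevCodim (A : Fin n → Fin n → ℤˣ) (d : Fin n) : ℕ :=
  Module.finrank ℝ (prevSpan A d)ᗮ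

lemma sqDist_nonneg (A : Fin n → Fin n → ℤˣ) (d : Fin n) : 0 ≤ sqDist A d := sq_nonneg _

lemma prevSpan_update (A : Fin n → Fin n → ℤˣ) (d : Fin n) (x : Fin n → ℤˣ) :
    prevSpan (Function.update A d x) d = prevSpan A d := by
  unfold prevSpan
  congr 1
  refine Set.image_congr fun r hr => ?_
  rw [Function.update_of_ne (ne_of_lt hr)]

lemma sqDist_update (A : Fin n → Fin n → ℤˣ) (d : Fin n) (x : Fin n → ℤˣ) :
    sqDist (Function.update A d x) d = ‖(prevSpan A d)ᗮ.starProjection (signVec x)‖ ^ 2 := by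
  simp only [sqDist, prevSpan_update, Function.update_self]

lemma prevCodim_update (A : Fin n → Fin n → ℤˣ) (d : Fin n) (x : Fin n → ℤˣ) :
    prevCodim (Function.update A d x) d = prevCodim A d := by
  unfold prevCodim
  rw [prevSpan_update]

lemma prevCodim_le (A : Fin n → Fin n → ℤˣ) (d : Fin n) : prevCodim A d ≤ n :=
  (Submodule.finrank_le _).trans (by simp)

/-- The preceding rows may be dependent, so deviations are measured against the true codimension and
`n - d` serves only as a lower bound. -/
lemma sub_le_prevCodim (A : Fin n → Fin n → ℤˣ) (d : Fin n) : n - d ≤ prevCodim A d := by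
  have h1 := (prevSpan A d).finrank_add_finrank_orthogonal
  rw [finrank_euclideanSpace_fin] at h1
  have h2 : Module.finrank ℝ (prevSpan A d) ≤ d := by
    have h3 : (fun r => signVec (A r)) '' Set.Iio d =
        (((Finset.Iio d).image fun r => signVec (A r) : Finset _) :
          Set (EuclideanSpace ℝ (Fin n))) := by simp
    rw [prevSpan, h3]
    refine (finrank_span_finset_le_card _).trans (Finset.card_image_le.trans ?_)
    simp
  unfold prevCodim
  omega

open InnerProductSpace in
-- Projecting off the preceding vectors leaves only the Gram–Schmidt vector of `f d`, whose norm is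
-- the inner product of its normalization with `f d`. If it vanishes, so does the left side.
lemma norm_starProjection_orthogonal_span_sq_le {E : Type*} [NormedAddCommGroup E]
    [InnerProductSpace ℝ E] [FiniteDimensional ℝ E]
    (h : Module.finrank ℝ E = Fintype.card (Fin n)) (f : Fin n → E) (d : Fin n) :
    ‖(Submodule.span ℝ (f '' Set.Iio d))ᗮ.starProjection (f d)‖ ^ 2 ≤
      inner ℝ (gramSchmidtOrthonormalBasis h f d) (f d) ^ 2 := by
  set V := Submodule.span ℝ (f '' Set.Iio d)
  have h1 : Vᗮ.starProjection (f d) = Vᗮ.starProjection (gramSchmidt ℝ f d) := by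
    rw [gramSchmidt_def, map_sub, eq_comm, sub_eq_self,
      Submodule.starProjection_apply_eq_zero_iff, Submodule.orthogonal_orthogonal]
    refine Submodule.sum_mem _ fun i hi => ?_
    rw [Submodule.starProjection_singleton]
    refine Submodule.smul_mem _ _ ?_
    simp only [V]
    rw [← span_gramSchmidt_Iio ℝ f d]
    exact Submodule.subset_span ⟨i, Finset.mem_Iio.1 hi, rfl⟩
  rw [h1]
  have h2 := Vᗮ.norm_starProjection_apply_le (gramSchmidt ℝ f d)
  by_cases h0 : gramSchmidt ℝ f d = 0
  · rw [h0, map_zero, norm_zero, zero_pow two_ne_zero]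
    exact sq_nonneg _
  · have h3 : gramSchmidtNormed ℝ f d ≠ 0 := by
      simp [gramSchmidtNormed, h0]
    have h4 : inner ℝ (gramSchmidt ℝ f d) (f d) = ‖gramSchmidt ℝ f d‖ ^ 2 := by
      conv_lhs => rw [gramSchmidt_def'' ℝ f d]
      rw [inner_add_right, inner_sum, Finset.sum_eq_zero, add_zero, real_inner_self_eq_norm_sq]
      intro i hi
      rw [inner_smul_right, gramSchmidt_orthogonal ℝ f (Finset.mem_Iio.1 hi).ne', mul_zero]
    rw [gramSchmidtOrthonormalBasis_apply h h3, gramSchmidtNormed, inner_smul_left, h4]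
    have h5 : ‖gramSchmidt ℝ f d‖ ≠ 0 := norm_ne_zero_iff.2 h0
    simp only [RCLike.ofReal_real_eq_id, id, map_inv₀, conj_trivial]
    rw [show ‖gramSchmidt ℝ f d‖⁻¹ * ‖gramSchmidt ℝ f d‖ ^ 2 = ‖gramSchmidt ℝ f d‖ by
      field_simp]
    gcongr

/-- In the Gram–Schmidt basis the rows are triangular, and the orthonormal change of basis has
determinant `±1`. -/
lemma prod_sqDist_le (A : Fin n → Fin n → ℤˣ) : ∏ d, sqDist A d ≤ signDet A ^ 2 := by
  have h : Module.finrank ℝ (EuclideanSpace ℝ (Fin n)) = Fintype.card (Fin n) := by simp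
  set f : Fin n → EuclideanSpace ℝ (Fin n) := fun r => signVec (A r)
  set b := InnerProductSpace.gramSchmidtOrthonormalBasis h f
  set e := EuclideanSpace.basisFun (Fin n) ℝ
  have h1 : signDet A = e.toBasis.det f := by
    rw [Module.Basis.det_apply, signDet, ← Matrix.det_transpose]
    congr 1
  have h2 : e.toBasis.det f = e.toBasis.det b * b.toBasis.det f := by
    simp only [Module.Basis.det_apply]
    rw [← Matrix.det_mul, ← b.coe_toBasis, Module.Basis.toMatrix_mul_toMatrix]
  have h3 : e.toBasis.det b ^ 2 = 1 := by
    rcases e.det_to_matrix_orthonormalBasis_real b with h | h <;> rw [h] <;> norm_num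
  rw [h1, h2, mul_pow, h3, one_mul, InnerProductSpace.gramSchmidtOrthonormalBasis_det,
    ← Finset.prod_pow]
  exact Finset.prod_le_prod (fun d _ => sqDist_nonneg A d) fun d _ =>
    norm_starProjection_orthogonal_span_sq_le h f d

end Volume

/-! ### Estimates for a single row -/

section Rows

open scoped BigOperators

variable {n : ℕ}

lemma expect_sq_sqDist_div_sub_one_le (d : Fin n) :
    𝔼 A : Fin n → Fin n → ℤˣ, (sqDist A d / prevCodim A d - 1) ^ 2 ≤ 2 / ((n - d : ℕ) : ℝ) := by
  refine expect_le_of_update d _ fun A => ?_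
  simp only [sqDist_update, prevCodim_update]
  have h1 : 0 < n - (d : ℕ) := Nat.sub_pos_of_lt d.2
  have h2 : ((n - d : ℕ) : ℝ) ≤ prevCodim A d := by exact_mod_cast sub_le_prevCodim A d
  have h3 : (0 : ℝ) < ((n - d : ℕ) : ℝ) := by exact_mod_cast h1
  have h4 := expect_sq_norm_starProjection_sub_le (prevSpan A d)ᗮ
  change _ ≤ 2 * (prevCodim A d : ℝ) at h4
  have hr : (0 : ℝ) < prevCodim A d := h3.trans_le h2
  calc 𝔼 x : Fin n → ℤˣ, (‖(prevSpan A d)ᗮ.starProjection (signVec x)‖ ^ 2 / prevCodim A d - 1) ^ 2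
      = (𝔼 x : Fin n → ℤˣ,
          (‖(prevSpan A d)ᗮ.starProjection (signVec x)‖ ^ 2 - prevCodim A d) ^ 2) /
          (prevCodim A d : ℝ) ^ 2 := by
        rw [Finset.expect_div]
        refine Finset.expect_congr rfl fun x _ => ?_
        field_simp
    _ ≤ 2 * prevCodim A d / (prevCodim A d : ℝ) ^ 2 := by
        gcongr
        exact h4
    _ = 2 / (prevCodim A d : ℝ) := by field_simp
    _ ≤ _ := by gcongr

lemma expect_abs_sqDist_div_sub_one_le (d : Fin n) :
    𝔼 A : Fin n → Fin n → ℤˣ, |sqDist A d / prevCodim A d - 1| ≤ √(2 / ((n - d : ℕ) : ℝ)) :=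
  (expect_abs_le_sqrt _).trans (Real.sqrt_le_sqrt (expect_sq_sqDist_div_sub_one_le d))

lemma freq_sqDist_lt_le (d : Fin n) :
    freq (fun A : Fin n → Fin n → ℤˣ => sqDist A d * n < 1) ≤ (1 / 2) ^ (n - d : ℕ) := by
  refine freq_le_of_update d _ fun A => ?_
  simp only [sqDist_update]
  simpa using freq_sq_norm_starProjection_lt_le (prevSpan A d)ᗮ (sub_le_prevCodim A d)

/-- Whether some normal is concentrated depends only on the rows before `d`. If none is,
Littlewood–Offord applies to row `d` and any normal vector. -/
lemma freq_sqDist_lt_le_centralBinom (d : Fin n) (l : ℕ) :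
    freq (fun A : Fin n → Fin n → ℤˣ => sqDist A d * n * ((n : ℝ) + 1) ^ 2 < 1) ≤
      (l.centralBinom : ℝ) / 4 ^ l + ((n : ℝ) * (2 * n + 3)) ^ (2 * l) * (1 / 2) ^ (d : ℕ) := by
  let bad : (Fin n → Fin n → ℤˣ) → Prop := fun A => ∃ v : Fin n → ℝ, (∀ i, |v i| ≤ 1) ∧
    (∃ i, v i = 1) ∧ (Finset.univ.filter fun i => 1 ≤ ((n : ℝ) + 1) * |v i|).card ≤ 2 * l ∧
      ∀ r ∈ Finset.Iio d, ∑ l, v l * sgnR (A r l) = 0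
  have hbad : freq bad ≤ ((n : ℝ) * (2 * n + 3)) ^ (2 * l) * (1 / 2) ^ (d : ℕ) := by
    have h := freq_exists_concentrated_normal_le (ι := Fin n) (Finset.Iio d) (2 * l)
    rwa [Fin.card_Iio, Fintype.card_fin] at h
  refine le_trans ((freq_mono fun A hA => ?_).trans (freq_or_le
    (fun A => ¬ bad A ∧ sqDist A d * n * ((n : ℝ) + 1) ^ 2 < 1) bad)) (add_le_add ?_ hbad)
  · by_cases h : bad A
    · exact Or.inr h
    · exact Or.inl ⟨h, hA⟩
  · refine freq_le_of_update d _ fun A => ?_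
    have h1 : ∀ x, bad (Function.update A d x) ↔ bad A := fun x => by
      simp only [bad]
      refine exists_congr fun v => and_congr_right fun _ => and_congr_right fun _ =>
        and_congr_right fun _ => forall₂_congr fun r hr => ?_
      rw [Function.update_of_ne (Finset.mem_Iio.1 hr).ne]
    simp only [sqDist_update, h1]
    by_cases h : bad A
    · refine (freq_mono (q := fun _ => False) fun x hx => hx.1 h).trans ?_
      simp only [freq, if_false, Finset.expect_const_zero]
      positivity
    · refine (freq_mono fun x hx => hx.2).trans ?_
      have hU : (prevSpan A d)ᗮ ≠ ⊥ := by
        intro h0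
        have := sub_le_prevCodim A d
        rw [prevCodim, h0, finrank_bot] at this
        have := d.2
        omega
      obtain ⟨u, huU, hu0⟩ := Submodule.exists_mem_ne_zero_of_ne_bot hU
      obtain ⟨v, hvU, hv, hvi⟩ := exists_sup_normalized huU hu0
      have hl : 2 * l ≤ (Finset.univ.filter fun i => 1 ≤ ((n : ℝ) + 1) * |v i|).card := by
        by_contra hlt
        refine h ⟨v, hv, hvi, (not_le.1 hlt).le, fun r hr => ?_⟩
        rw [← inner_signVec, real_inner_comm]
        exact (Submodule.mem_orthogonal _ _).1 hvU _
          (Submodule.subset_span ⟨r, Finset.mem_Iio.1 hr, rfl⟩)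
      simpa using freq_sq_norm_starProjection_lt_le_centralBinom hvU hv
        (by positivity : (0 : ℝ) < (n : ℝ) + 1) hl

end Rows

/-! ### The lower bound for the determinant -/

section LowerBound

open scoped BigOperators

variable {n : ℕ}

/-- A quantity whose exponential bounds the loss of one row with respect to its mean. -/
noncomputable def rowLoss (A : Fin n → Fin n → ℤˣ) (d : Fin n) : ℝ :=
  2 * |sqDist A d / prevCodim A d - 1| +
    8 * Real.log n * (sqDist A d / prevCodim A d - 1) ^ 2

lemma rowLoss_nonneg (A : Fin n → Fin n → ℤˣ) (d : Fin n) : 0 ≤ rowLoss A d := by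
  have := Real.log_natCast_nonneg n
  unfold rowLoss
  positivity

/-- For `y ≥ 1 / 2`, `log y ≥ 1 - 1 / y ≥ -2 * |y - 1|`. Otherwise `(y - 1) ^ 2 ≥ 1 / 4`, and the
quadratic term alone exceeds `2 * log n ≥ -log y`. -/
lemma exp_neg_le_of_inv_sq_le {y : ℝ} (hn : 1 ≤ n) (hy : 1 / (n : ℝ) ^ 2 ≤ y) :
    Real.exp (-(2 * |y - 1| + 8 * Real.log n * (y - 1) ^ 2)) ≤ y := by
  have hn0 : (0 : ℝ) < n := by exact_mod_cast hn
  have hlog := Real.log_natCast_nonneg n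
  have hy0 : 0 < y := lt_of_lt_of_le (by positivity) hy
  rw [← Real.le_log_iff_exp_le hy0]
  rcases le_or_gt (1 / 2) y with h | h
  · have h1 := Real.one_sub_inv_le_log_of_pos hy0
    have h2 : -(2 * |y - 1|) ≤ 1 - y⁻¹ := by
      have h3 : y⁻¹ ≤ 2 := by rw [inv_le_comm₀ hy0 two_pos]; linarith
      have h4 : 1 - y⁻¹ = (y - 1) * y⁻¹ := by field_simp
      rw [h4]
      have h5 : |(y - 1) * y⁻¹| ≤ |y - 1| * 2 := by
        rw [abs_mul, abs_of_pos (inv_pos.2 hy0)]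
        gcongr
      linarith [neg_abs_le ((y - 1) * y⁻¹)]
    have : 0 ≤ 8 * Real.log n * (y - 1) ^ 2 := by positivity
    linarith
  · have h1 : -(2 * Real.log n) ≤ Real.log y := by
      have := Real.log_le_log (by positivity) hy
      rw [one_div, Real.log_inv, Real.log_pow] at this
      exact_mod_cast this
    have h2 : 1 / 4 ≤ (y - 1) ^ 2 := by nlinarith
    have h3 : 8 * Real.log n * (1 / 4) ≤ 8 * Real.log n * (y - 1) ^ 2 := by gcongr
    linarith [abs_nonneg (y - 1)]

lemma mul_exp_neg_rowLoss_le (A : Fin n → Fin n → ℤˣ) (d : Fin n) (h : 1 ≤ sqDist A d * n) :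
    ((n - d : ℕ) : ℝ) * Real.exp (-rowLoss A d) ≤ sqDist A d := by
  have hn : 0 < n := d.pos
  have hn0 : (0 : ℝ) < n := by exact_mod_cast hn
  have h1 : ((n - d : ℕ) : ℝ) ≤ prevCodim A d := by exact_mod_cast sub_le_prevCodim A d
  have h2 : (0 : ℝ) < ((n - d : ℕ) : ℝ) := by exact_mod_cast Nat.sub_pos_of_lt d.2
  have hr : (0 : ℝ) < prevCodim A d := h2.trans_le h1
  have hrn : (prevCodim A d : ℝ) ≤ n := by exact_mod_cast prevCodim_le A d
  have h3 : 1 / (n : ℝ) ^ 2 ≤ sqDist A d / prevCodim A d := by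
    rw [div_le_div_iff₀ (by positivity) hr]
    nlinarith
  have h4 := exp_neg_le_of_inv_sq_le hn h3
  calc ((n - d : ℕ) : ℝ) * Real.exp (-rowLoss A d)
      ≤ prevCodim A d * (sqDist A d / prevCodim A d) := by
        gcongr
        exact h4
    _ = _ := by field_simp

lemma sum_fin_sub {M : Type*} [AddCommMonoid M] (f : ℕ → M) :
    ∑ d : Fin n, f (n - d) = ∑ j ∈ Finset.range n, f (j + 1) := by
  rw [Fin.sum_univ_eq_sum_range (fun d => f (n - d)),
    ← Finset.sum_range_reflect (fun j => f (j + 1))]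
  refine Finset.sum_congr rfl fun d hd => ?_
  have := Finset.mem_range.1 hd
  congr 1
  omega

lemma prod_fin_sub : ∏ d : Fin n, ((n - d : ℕ) : ℝ) = n ! := by
  rw [Fin.prod_univ_eq_prod_range (fun d => ((n - d : ℕ) : ℝ)),
    ← Finset.prod_range_add_one_eq_factorial, ← Finset.prod_range_reflect]
  push_cast
  refine Finset.prod_congr rfl fun d hd => ?_
  have := Finset.mem_range.1 hd
  rw [show n - (n - 1 - d) = d + 1 by omega]
  push_cast
  rfl

lemma card_filter_sub_lt_le (k : ℕ) :
    (Finset.univ.filter fun d : Fin n => n - (d : ℕ) < k).card ≤ k := by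
  rw [Finset.card_filter, sum_fin_sub (fun j => if j < k then 1 else 0), ← Finset.card_filter]
  refine (Finset.card_le_card (t := Finset.range k) fun j hj => ?_).trans (by simp)
  rw [Finset.mem_filter] at hj
  exact Finset.mem_range.2 (by omega)

lemma factorial_mul_exp_le_signDet_sq (A : Fin n → Fin n → ℤˣ) (k : ℕ) {T : ℝ}
    (h1 : ∀ d : Fin n, k ≤ n - (d : ℕ) → 1 ≤ sqDist A d * n)
    (h2 : ∀ d : Fin n, n - (d : ℕ) < k → 1 ≤ sqDist A d * n * ((n : ℝ) + 1) ^ 2)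
    (hT : ∑ d, rowLoss A d ≤ T) :
    (n ! : ℝ) * Real.exp (-T) * (1 / ((n : ℝ) ^ 2 * ((n : ℝ) + 1) ^ 2)) ^ k ≤ signDet A ^ 2 := by
  set c : ℝ := 1 / ((n : ℝ) ^ 2 * ((n : ℝ) + 1) ^ 2) with hc
  have hc0 : 0 ≤ c := by positivity
  have hc1 : c ≤ 1 := by
    rcases Nat.eq_zero_or_pos n with h | h
    · rw [hc]; subst h; norm_num
    · have : (1 : ℝ) ≤ n := by exact_mod_cast h
      rw [hc, div_le_one (by positivity)]
      nlinarith [one_le_pow₀ this (n := 2), one_le_pow₀ (show (1 : ℝ) ≤ n + 1 by linarith) (n := 2)]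
  refine le_trans ?_ (prod_sqDist_le A)
  calc (n ! : ℝ) * Real.exp (-T) * c ^ k
      ≤ (∏ d : Fin n, ((n - d : ℕ) : ℝ)) * (∏ d : Fin n, Real.exp (-rowLoss A d)) *
          ∏ d : Fin n, (if n - (d : ℕ) < k then c else 1) := by
        rw [prod_fin_sub, ← Real.exp_sum, Finset.sum_neg_distrib, Finset.prod_ite,
          Finset.prod_const, Finset.prod_const_one, mul_one]
        gcongr ?_ * ?_ * ?_
        · exact Real.exp_le_exp.2 (neg_le_neg hT)
        · exact pow_le_pow_of_le_one hc0 hc1 (card_filter_sub_lt_le k)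
    _ = ∏ d : Fin n, (((n - d : ℕ) : ℝ) * Real.exp (-rowLoss A d) *
          (if n - (d : ℕ) < k then c else 1)) := by
        rw [Finset.prod_mul_distrib, Finset.prod_mul_distrib]
    _ ≤ ∏ d, sqDist A d := by
        refine Finset.prod_le_prod (fun d _ => ?_) fun d _ => ?_
        · split_ifs <;> positivity
        · split_ifs with h
          · have hn : (0 : ℝ) < n := by exact_mod_cast d.pos
            have h3 : ((n - d : ℕ) : ℝ) ≤ n := by exact_mod_cast Nat.sub_le _ _
            have h4 : Real.exp (-rowLoss A d) ≤ 1 :=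
              Real.exp_le_one_iff.2 (neg_nonpos.2 (rowLoss_nonneg A d))
            have h5 : 1 / ((n : ℝ) * ((n : ℝ) + 1) ^ 2) ≤ sqDist A d := by
              rw [div_le_iff₀ (by positivity)]
              linarith [h2 d h]
            -- One factor `n` of `c` absorbs `n - d`; what remains is the polynomial floor for the
            -- last rows.
            calc ((n - d : ℕ) : ℝ) * Real.exp (-rowLoss A d) * c ≤ n * 1 * c := by gcongr
              _ = 1 / ((n : ℝ) * ((n : ℝ) + 1) ^ 2) := by rw [hc]; field_simp
              _ ≤ _ := h5
          · rw [mul_one]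
            exact mul_exp_neg_rowLoss_le A d (h1 d (not_lt.1 h))

lemma sum_sqrt_two_div_le (n : ℕ) :
    ∑ j ∈ Finset.range n, √(2 / ((j + 1 : ℕ) : ℝ)) ≤ 3 * √n := by
  induction n with
  | zero => simp
  | succ n ih =>
    rw [Finset.sum_range_succ]
    have h1 : √(2 / ((n + 1 : ℕ) : ℝ)) ≤ 3 * √((n + 1 : ℕ) : ℝ) - 3 * √n := by
      have ha : 0 < √((n + 1 : ℕ) : ℝ) := Real.sqrt_pos.2 (by positivity)
      have hb : 0 ≤ √(n : ℝ) := Real.sqrt_nonneg _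
      have ha2 : √((n + 1 : ℕ) : ℝ) ^ 2 = n + 1 := by
        rw [Real.sq_sqrt (by positivity)]; push_cast; rfl
      have hb2 : √(n : ℝ) ^ 2 = n := Real.sq_sqrt (by positivity)
      rw [Real.sqrt_div (by norm_num), div_le_iff₀ ha]
      have h2 : √2 ≤ 3 / 2 := by
        rw [Real.sqrt_le_left (by norm_num)]; norm_num
      nlinarith [sq_nonneg (√((n + 1 : ℕ) : ℝ) - √n)]
    linarith

/-- The mean absolute deviations give the `√n`; the quadratic terms give a harmonic sum, hence only
`log ^ 2`. -/
lemma expect_sum_rowLoss_le :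
    𝔼 A : Fin n → Fin n → ℤˣ, ∑ d, rowLoss A d ≤
      6 * √n + 16 * Real.log n * (1 + Real.log n) := by
  have hlog := Real.log_natCast_nonneg n
  have h1 : ∀ d : Fin n, 𝔼 A : Fin n → Fin n → ℤˣ, rowLoss A d ≤
      2 * √(2 / ((n - d : ℕ) : ℝ)) + 16 * Real.log n * ((n - d : ℕ) : ℝ)⁻¹ := fun d => by
    unfold rowLoss
    rw [Finset.expect_add_distrib, ← Finset.mul_expect, ← Finset.mul_expect]
    refine add_le_add (by gcongr; exact expect_abs_sqDist_div_sub_one_le d) ?_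
    calc _ ≤ 8 * Real.log n * (2 / ((n - d : ℕ) : ℝ)) := by
          gcongr
          exact expect_sq_sqDist_div_sub_one_le d
      _ = _ := by ring
  rw [Finset.expect_sum_comm]
  refine (Finset.sum_le_sum fun d _ => h1 d).trans ?_
  rw [sum_fin_sub (fun j => 2 * √(2 / (j : ℝ)) + 16 * Real.log n * (j : ℝ)⁻¹),
    Finset.sum_add_distrib, ← Finset.mul_sum, ← Finset.mul_sum]
  have h2 := sum_sqrt_two_div_le n
  have h3 := harmonic_le_one_add_log n
  rw [harmonic] at h3
  push_cast at h3 h2 ⊢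
  have h4 := mul_le_mul_of_nonneg_left h3 (by positivity : (0 : ℝ) ≤ 16 * Real.log n)
  linarith

/-- A quantitative lower bound for the determinant of a random sign matrix. -/
lemma freq_not_factorial_mul_exp_le_signDet_sq_le (k l : ℕ) {T : ℝ} (hT : 0 < T) :
    freq (fun A : Fin n → Fin n → ℤˣ => ¬ ((n ! : ℝ) * Real.exp (-T) *
        (1 / ((n : ℝ) ^ 2 * ((n : ℝ) + 1) ^ 2)) ^ k ≤ signDet A ^ 2)) ≤
      2 * (1 / 2) ^ k + k * (1 / √(2 * l + 1) +
        ((n : ℝ) * (2 * n + 3)) ^ (2 * l) * (2 ^ k * (1 / 2) ^ n)) +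
        (6 * √n + 16 * Real.log n * (1 + Real.log n)) / T := by
  let S₁ := Finset.univ.filter fun d : Fin n => k ≤ n - (d : ℕ)
  let S₂ := Finset.univ.filter fun d : Fin n => n - (d : ℕ) < k
  -- Failure has three causes: a short early row, a very short row among the last ones, or a large
  -- total loss.
  refine le_trans ((freq_mono (q := fun A => ((∃ d ∈ S₁, sqDist A d * n < 1) ∨
    ∃ d ∈ S₂, sqDist A d * n * ((n : ℝ) + 1) ^ 2 < 1) ∨ T < ∑ d, rowLoss A d)
    fun A hA => ?_).trans ((freq_or_le _ _).trans (add_le_add_left (freq_or_le _ _) _)))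
    (add_le_add (add_le_add ?_ ?_) ?_)
  · by_contra! h
    refine hA (factorial_mul_exp_le_signDet_sq A k (fun d hd => h.1.1 d ?_)
      (fun d hd => h.1.2 d ?_) h.2)
    · exact Finset.mem_filter.2 ⟨Finset.mem_univ d, hd⟩
    · exact Finset.mem_filter.2 ⟨Finset.mem_univ d, hd⟩
  · refine (freq_exists_le _ _).trans
      ((Finset.sum_le_sum fun d _ => freq_sqDist_lt_le d).trans ?_)
    rw [Finset.sum_filter, sum_fin_sub (fun j => if k ≤ j then (1 / 2 : ℝ) ^ j else 0),
      ← Finset.sum_filter]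
    calc ∑ j ∈ (Finset.range n).filter (fun j => k ≤ j + 1), (1 / 2 : ℝ) ^ (j + 1)
        ≤ ∑ j ∈ Finset.Ico k (n + 1), (1 / 2 : ℝ) ^ j := by
          refine le_trans (Finset.sum_map _ ⟨fun j : ℕ => j + 1, add_left_injective 1⟩
            (fun j => (1 / 2 : ℝ) ^ j)).ge ?_
          refine Finset.sum_le_sum_of_subset_of_nonneg (fun j hj => ?_) fun _ _ _ => by positivity
          simp only [Finset.mem_map, Finset.mem_filter, Finset.mem_range,
            Function.Embedding.coeFn_mk] at hj
          obtain ⟨i, hi, rfl⟩ := hj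
          exact Finset.mem_Ico.2 (by omega)
      _ ≤ 2 * (1 / 2) ^ k := by
          rcases le_or_gt k (n + 1) with h | h
          · rw [geom_sum_Ico (by norm_num) h]
            have : (0 : ℝ) ≤ (1 / 2) ^ (n + 1) := by positivity
            rw [show (1 / 2 - 1 : ℝ) = -(1 / 2) by norm_num, div_neg, div_div_eq_mul_div]
            linarith
          · rw [Finset.Ico_eq_empty_of_le h.le]
            simp
  · refine (freq_exists_le _ _).trans ((Finset.sum_le_card_nsmul _ _
      (1 / √(2 * l + 1) + ((n : ℝ) * (2 * n + 3)) ^ (2 * l) * (2 ^ k * (1 / 2) ^ n))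
        fun d hd => ?_).trans ?_)
    · refine (freq_sqDist_lt_le_centralBinom d l).trans ?_
      have hd' : n ≤ k + d := by
        have := (Finset.mem_filter.1 hd).2
        omega
      refine add_le_add (centralBinom_div_le l) (mul_le_mul_of_nonneg_left ?_ (by positivity))
      calc (1 / 2 : ℝ) ^ (d : ℕ) = 2 ^ k * (1 / 2) ^ (k + d) := by
            rw [pow_add, ← mul_assoc, ← mul_pow]; norm_num
        _ ≤ _ := mul_le_mul_of_nonneg_left
            (pow_le_pow_of_le_one (by norm_num) (by norm_num) hd') (by positivity)
    · rw [nsmul_eq_mul]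
      gcongr
      exact card_filter_sub_lt_le k
  · refine (freq_lt_le_expect_div (fun A => Finset.sum_nonneg fun d _ => rowLoss_nonneg A d)
      hT).trans ?_
    gcongr
    exact expect_sum_rowLoss_le

end LowerBound

/-! ### Second moment and symmetry of the determinant -/

section Moments

open scoped BigOperators

variable {n : ℕ}

/-- Reversal of one entry of a sign matrix. -/
def flipEntry (a b : Fin n) : (Fin n → Fin n → ℤˣ) ≃ (Fin n → Fin n → ℤˣ) :=
  Function.Involutive.toPerm (fun A => Function.update A a (flipSign b (A a))) fun A => by
    have : ∀ x : Fin n → ℤˣ, flipSign b (flipSign b x) = x := (flipSign b).left_inv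
    simp [this]

lemma flipEntry_apply (a b : Fin n) (A : Fin n → Fin n → ℤˣ) :
    flipEntry a b A = Function.update A a (flipSign b (A a)) := rfl

lemma flipEntry_same (a b : Fin n) (A : Fin n → Fin n → ℤˣ) : flipEntry a b A a b = -A a b := by
  simp [flipEntry_apply, flipSign_same]

lemma flipEntry_of_ne {a b i j : Fin n} (h : i ≠ a ∨ j ≠ b) (A : Fin n → Fin n → ℤˣ) :
    flipEntry a b A i j = A i j := by
  rcases eq_or_ne i a with rfl | hi
  · have hj := h.resolve_left (by simp)
    simp [flipEntry_apply, flipSign_of_ne hj]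
  · simp [flipEntry_apply, hi]

lemma prod_sgnR_flipEntry_same (σ : Equiv.Perm (Fin n)) (b : Fin n) (A : Fin n → Fin n → ℤˣ) :
    ∏ j, sgnR (flipEntry (σ b) b A (σ j) j) = -∏ j, sgnR (A (σ j) j) := by
  rw [← Finset.mul_prod_erase _ _ (Finset.mem_univ b),
    ← Finset.mul_prod_erase _ (fun j => sgnR (A (σ j) j)) (Finset.mem_univ b), flipEntry_same,
    Finset.prod_congr rfl fun j hj => by rw [flipEntry_of_ne (Or.inr (Finset.ne_of_mem_erase hj))]]
  rw [sgnR_neg, neg_mul]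

lemma prod_sgnR_flipEntry_of_ne {σ τ : Equiv.Perm (Fin n)} {b : Fin n} (h : σ b ≠ τ b)
    (A : Fin n → Fin n → ℤˣ) :
    ∏ j, sgnR (flipEntry (σ b) b A (τ j) j) = ∏ j, sgnR (A (τ j) j) := by
  refine Finset.prod_congr rfl fun j _ => ?_
  rw [flipEntry_of_ne]
  rcases eq_or_ne j b with rfl | hj
  · exact Or.inl h.symm
  · exact Or.inr hj

/-- If `σ b ≠ τ b`, flipping the entry `(σ b, b)` negates the first product and preserves the
second. -/
lemma expect_prod_sgnR_mul_prod_sgnR (σ τ : Equiv.Perm (Fin n)) :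
    𝔼 A : Fin n → Fin n → ℤˣ, (∏ j, sgnR (A (σ j) j)) * ∏ j, sgnR (A (τ j) j) =
      if σ = τ then 1 else 0 := by
  split_ifs with h
  · subst h
    simp [← Finset.prod_mul_distrib]
  · obtain ⟨b, hb⟩ : ∃ b, σ b ≠ τ b := by
      by_contra! hall
      exact h (Equiv.ext hall)
    have h1 : 𝔼 A : Fin n → Fin n → ℤˣ, (∏ j, sgnR (flipEntry (σ b) b A (σ j) j)) *
        ∏ j, sgnR (flipEntry (σ b) b A (τ j) j) =
        𝔼 A : Fin n → Fin n → ℤˣ, (∏ j, sgnR (A (σ j) j)) * ∏ j, sgnR (A (τ j) j) :=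
      Fintype.expect_equiv (flipEntry (σ b) b) _ _ fun _ => rfl
    simp only [prod_sgnR_flipEntry_same, prod_sgnR_flipEntry_of_ne hb, neg_mul,
      Finset.expect_neg_distrib] at h1
    linarith

/-- The second moment of the determinant of a random sign matrix is `n!`. -/
lemma expect_signDet_sq : 𝔼 A : Fin n → Fin n → ℤˣ, signDet A ^ 2 = n ! := by
  have h1 : ∀ A : Fin n → Fin n → ℤˣ, signDet A ^ 2 = ∑ σ : Equiv.Perm (Fin n),
      ∑ τ : Equiv.Perm (Fin n), (((Equiv.Perm.sign σ : ℤ) : ℝ) * ((Equiv.Perm.sign τ : ℤ) : ℝ)) *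
        ((∏ j, sgnR (A (σ j) j)) * ∏ j, sgnR (A (τ j) j)) := fun A => by
    rw [signDet, Matrix.det_apply', sq, Finset.sum_mul_sum]
    refine Finset.sum_congr rfl fun σ _ => Finset.sum_congr rfl fun τ _ => ?_
    simp only [Matrix.of_apply]
    ring
  simp only [h1, Finset.expect_sum_comm, ← Finset.mul_expect, expect_prod_sgnR_mul_prod_sgnR]
  simp only [mul_ite, mul_one, mul_zero, Finset.sum_ite_eq, Finset.mem_univ, if_true]
  have h2 : ∀ σ : Equiv.Perm (Fin n),
      ((Equiv.Perm.sign σ : ℤ) : ℝ) * ((Equiv.Perm.sign σ : ℤ) : ℝ) = 1 := fun σ =>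
    sgnR_mul_self (Equiv.Perm.sign σ)
  simp [h2, Fintype.card_perm]

lemma freq_neg_signDet (hn : 0 < n) (p : ℝ → Prop) :
    freq (fun A : Fin n → Fin n → ℤˣ => p (-signDet A)) =
      freq (fun A : Fin n → Fin n → ℤˣ => p (signDet A)) := by
  let i : Fin n := ⟨0, hn⟩
  let e : (Fin n → Fin n → ℤˣ) ≃ (Fin n → Fin n → ℤˣ) :=
    Function.Involutive.toPerm (fun A => Function.update A i (-A i)) fun A => by simp
  have happ : ∀ A, e A = Function.update A i (-A i) := fun A => rfl
  have he : ∀ A, signDet (e A) = -signDet A := fun A => by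
    have h1 : (Matrix.of fun r j => sgnR (e A r j)) = (Matrix.of fun r j => sgnR (A r j)).updateRow i
        ((-1 : ℝ) • (Matrix.of fun r j => sgnR (A r j)) i) := by
      ext r j
      rcases eq_or_ne r i with rfl | hr
      · simp [happ]
      · simp [happ, hr]
    rw [signDet, h1, Matrix.det_updateRow_smul, Matrix.updateRow_eq_self, signDet]
    ring
  rw [← freq_comp_equiv e]
  simp only [he, neg_neg]

end Moments

/-! ### Limits -/

section Limits

lemma tendsto_sqrt_natCast : Tendsto (fun n : ℕ => √(n : ℝ)) atTop atTop :=
  Real.tendsto_sqrt_atTop.comp tendsto_natCast_atTop_atTop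

lemma tendsto_log_natCast : Tendsto (fun n : ℕ => Real.log n) atTop atTop :=
  Real.tendsto_log_atTop.comp tendsto_natCast_atTop_atTop

lemma eventually_sqrt_le_sqrt_mul_log : ∀ᶠ n : ℕ in atTop, √(n : ℝ) ≤ √(n * Real.log n) := by
  filter_upwards [tendsto_log_natCast.eventually_ge_atTop 1] with n hn
  exact Real.sqrt_le_sqrt (le_mul_of_one_le_right (Nat.cast_nonneg n) hn)

lemma eventually_pow_le_exp_sqrt (k : ℕ) :
    ∀ᶠ n : ℕ in atTop, ((n : ℝ) ^ 2 * ((n : ℝ) + 1) ^ 2) ^ k ≤ Real.exp (√n) := by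
  have h1 := ((Real.tendsto_pow_mul_exp_neg_atTop_nhds_zero (8 * k)).comp
    tendsto_sqrt_natCast).eventually_lt_const (by positivity : (0 : ℝ) < 1 / 4 ^ k)
  filter_upwards [h1, eventually_ge_atTop 1] with n hn h1n
  have h1n' : (1 : ℝ) ≤ n := by exact_mod_cast h1n
  simp only [Function.comp_apply] at hn
  rw [Real.exp_neg, ← div_eq_mul_inv, div_lt_div_iff₀ (Real.exp_pos _) (by positivity), one_mul]
    at hn
  calc ((n : ℝ) ^ 2 * ((n : ℝ) + 1) ^ 2) ^ k ≤ ((n : ℝ) ^ 2 * (n + n) ^ 2) ^ k := by gcongr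
    _ = √(n : ℝ) ^ (8 * k) * 4 ^ k := by
      rw [pow_mul, show √(n : ℝ) ^ 8 = (√(n : ℝ) ^ 2) ^ 4 by ring, Real.sq_sqrt (by positivity),
        ← mul_pow]
      ring
    _ ≤ _ := hn.le

lemma tendsto_loss_div_sqrt : Tendsto (fun n : ℕ =>
    (6 * √n + 16 * Real.log n * (1 + Real.log n)) / √(n * Real.log n)) atTop (𝓝 0) := by
  have h1 : Tendsto (fun n : ℕ => 134 / √(Real.log n)) atTop (𝓝 0) :=
    tendsto_const_nhds.div_atTop (Real.tendsto_sqrt_atTop.comp tendsto_log_natCast)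
  -- At `x = √n` this says `log n ^ 2 ≤ 4 * √n`. With `log n ≥ 1` the numerator is at most `(6 + 32
  -- * 4) * √n`, whence `134`.
  have h2 : ∀ᶠ x : ℝ in atTop, ‖Real.log x ^ 2‖ ≤ 1 * ‖id x‖ :=
    (Real.isLittleO_pow_log_id_atTop (n := 2)).bound one_pos
  refine squeeze_zero' ?_ ?_ h1
  · filter_upwards with n
    have := Real.log_natCast_nonneg n
    positivity
  · filter_upwards [tendsto_sqrt_natCast.eventually h2,
      tendsto_log_natCast.eventually_ge_atTop 1, eventually_ge_atTop 1] with n h3 h4 h5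
    have hn : (0 : ℝ) < n := by exact_mod_cast h5
    rw [one_mul, id, Real.norm_of_nonneg (by positivity), Real.norm_of_nonneg (by positivity),
      Real.log_sqrt hn.le] at h3
    have hs : 0 < √(n : ℝ) := Real.sqrt_pos.2 hn
    have hl : 0 < √(Real.log n) := Real.sqrt_pos.2 (by linarith)
    rw [Real.sqrt_mul hn.le, div_le_div_iff₀ (by positivity) hl, ← mul_assoc]
    refine mul_le_mul_of_nonneg_right ?_ hl.le
    nlinarith

/-- The logarithm of the determinant of a random sign matrix is rarely much smaller than the one of
its root mean square. -/
lemma tendsto_freq_not_le_abs_signDet : Tendsto (fun n : ℕ =>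
    freq (fun A : Fin n → Fin n → ℤˣ =>
      ¬ √(n ! : ℝ) * Real.exp (-29 * √(n * Real.log n)) ≤ |signDet A|)) atTop (𝓝 0) := by
  refine tendsto_order.2 ⟨fun a ha => Eventually.of_forall fun n => ha.trans_le (freq_nonneg _),
    fun ε hε => ?_⟩
  -- The order of choices matters: `k` from `ε`, then `l` from `k`, and only then `n` large. Each of
  -- the four error terms gets `ε / 4`.
  obtain ⟨k, hk⟩ := exists_pow_lt_of_lt_one (by positivity : 0 < ε / 8)
    (by norm_num : (1 / 2 : ℝ) < 1)
  have hl : Tendsto (fun l : ℕ => (k : ℝ) * (1 / √(2 * l + 1))) atTop (𝓝 (k * 0)) := by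
    refine (tendsto_const_nhds.div_atTop (Real.tendsto_sqrt_atTop.comp ?_)).const_mul _
    exact tendsto_atTop_add_const_right _ _
      (tendsto_natCast_atTop_atTop.const_mul_atTop two_pos)
  rw [mul_zero] at hl
  obtain ⟨l, hl⟩ := (hl.eventually_lt_const (by positivity : 0 < ε / 4)).exists
  have h3 : Tendsto (fun n : ℕ => (k : ℝ) * 5 ^ (2 * l) * 2 ^ k * ((n : ℝ) ^ (4 * l) * (1 / 2) ^ n))
      atTop (𝓝 ((k : ℝ) * 5 ^ (2 * l) * 2 ^ k * 0)) :=
    (tendsto_pow_const_mul_const_pow_of_abs_lt_one (4 * l)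
      (by rw [abs_of_pos] <;> norm_num)).const_mul _
  rw [mul_zero] at h3
  filter_upwards [h3.eventually_lt_const (by positivity : 0 < ε / 4),
    tendsto_loss_div_sqrt.eventually_lt_const (by positivity : 0 < ε / 4),
    eventually_pow_le_exp_sqrt k, eventually_sqrt_le_sqrt_mul_log, eventually_ge_atTop 1]
    with n h4 h5 h6 h7 h8
  have hn : (1 : ℝ) ≤ n := by exact_mod_cast h8
  set s := √(n * Real.log n) with hs
  have hs0 : 0 < s := (Real.sqrt_pos.2 (by linarith)).trans_le h7
  have hincl : ∀ A : Fin n → Fin n → ℤˣ, (n ! : ℝ) * Real.exp (-s) *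
      (1 / ((n : ℝ) ^ 2 * ((n : ℝ) + 1) ^ 2)) ^ k ≤ signDet A ^ 2 →
      √(n ! : ℝ) * Real.exp (-29 * s) ≤ |signDet A| := fun A h => by
    refine (pow_le_pow_iff_left₀ (by positivity) (abs_nonneg _) two_ne_zero).1 ?_
    rw [sq_abs]
    refine le_trans ?_ h
    rw [mul_pow, Real.sq_sqrt (by positivity), mul_assoc]
    refine mul_le_mul_of_nonneg_left ?_ (by positivity)
    have h9 : Real.exp (-s) ≤ (1 / ((n : ℝ) ^ 2 * ((n : ℝ) + 1) ^ 2)) ^ k := by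
      rw [one_div_pow, Real.exp_neg, ← one_div]
      exact one_div_le_one_div_of_le (by positivity) (h6.trans (Real.exp_le_exp.2 h7))
    -- One factor `exp (-s)` pays for the total loss, the other for the last `k` rows; the constant
    -- `29` leaves ample room.
    calc Real.exp (-29 * s) ^ 2 ≤ Real.exp (-s) * Real.exp (-s) := by
          rw [← Real.exp_nat_mul, ← Real.exp_add, Real.exp_le_exp]
          push_cast
          linarith
      _ ≤ _ := by gcongr
  refine lt_of_le_of_lt ((freq_mono fun A hA h => hA (hincl A h)).trans
    (freq_not_factorial_mul_exp_le_signDet_sq_le k l hs0)) ?_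
  have h10 : (k : ℝ) * (((n : ℝ) * (2 * n + 3)) ^ (2 * l) * (2 ^ k * (1 / 2) ^ n)) ≤
      (k : ℝ) * 5 ^ (2 * l) * 2 ^ k * ((n : ℝ) ^ (4 * l) * (1 / 2) ^ n) := by
    calc (k : ℝ) * (((n : ℝ) * (2 * n + 3)) ^ (2 * l) * (2 ^ k * (1 / 2) ^ n))
        ≤ (k : ℝ) * ((5 * (n : ℝ) ^ 2) ^ (2 * l) * (2 ^ k * (1 / 2) ^ n)) := by
          have h11 : (n : ℝ) * (2 * n + 3) ≤ 5 * (n : ℝ) ^ 2 := by nlinarith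
          gcongr ?_ * (?_ * _)
          exact pow_le_pow_left₀ (by positivity) h11 _
      _ = _ := by
          rw [mul_pow, ← pow_mul, show 2 * (2 * l) = 4 * l by ring]
          ring
  rw [mul_add]
  linarith

/-- Markov's inequality for the square, whose mean is `n!`, bounds the failure probability by `exp
(-58 * s)`. -/
lemma tendsto_freq_not_abs_signDet_le : Tendsto (fun n : ℕ =>
    freq (fun A : Fin n → Fin n → ℤˣ =>
      ¬ |signDet A| ≤ √(n ! : ℝ) * Real.exp (29 * √(n * Real.log n)))) atTop (𝓝 0) := by
  have h1 : Tendsto (fun n : ℕ => Real.exp (-√(n : ℝ))) atTop (𝓝 0) :=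
    Real.tendsto_exp_neg_atTop_nhds_zero.comp tendsto_sqrt_natCast
  refine squeeze_zero' (Eventually.of_forall fun n => freq_nonneg _) ?_ h1
  filter_upwards [eventually_sqrt_le_sqrt_mul_log] with n hn
  set s := √(n * Real.log n)
  have hf : (0 : ℝ) < n ! := by exact_mod_cast n.factorial_pos
  have hs : 0 ≤ s := Real.sqrt_nonneg _
  refine (freq_mono (q := fun A => (n ! : ℝ) * Real.exp (29 * s) ^ 2 < signDet A ^ 2)
    fun A hA => ?_).trans ((freq_lt_le_expect_div (fun A => sq_nonneg _) (by positivity)).trans ?_)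
  · have h2 := pow_lt_pow_left₀ (not_le.1 hA) (by positivity) two_ne_zero
    rwa [mul_pow, Real.sq_sqrt hf.le, sq_abs] at h2
  · rw [expect_signDet_sq, div_mul_cancel_left₀ hf.ne', ← Real.exp_nat_mul, ← Real.exp_neg,
      Real.exp_le_exp]
    push_cast
    linarith

end Limits

/-! ### The uniform measure on sign matrices -/

section UniformMeasure

lemma range_signMatrix (n : ℕ) :
    Set.range (fun A : Fin n → Fin n → ℤˣ => (Matrix.of fun i j => sgnR (A i j))) =
      signMatrices n := by
  ext M
  constructor
  · rintro ⟨A, rfl⟩ i j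
    rcases Int.units_eq_one_or (A i j) with h | h <;> simp [h, sgnR]
  · intro hM
    refine ⟨fun i j => if M i j = 1 then 1 else -1, ?_⟩
    ext i j
    rcases hM i j with h | h
    · simp [h, sgnR]
    · have : (-1 : ℝ) ≠ 1 := by norm_num
      simp [h, sgnR, this]

lemma bernoulliMatrix_real_det (n : ℕ) (p : ℝ → Prop) :
    (bernoulliMatrix n).real {M | p M.det} =
      freq (fun A : Fin n → Fin n → ℤˣ => p (signDet A)) := by
  classical
  let toMat : (Fin n → Fin n → ℤˣ) → Matrix (Fin n) (Fin n) ℝ := fun A => Matrix.of fun i j =>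
    sgnR (A i j)
  have htoMat : Function.Injective toMat := fun A B h => by
    funext i j
    exact sgnR_injective (congrFun (congrFun h i) j)
  have h1 : signMatrices n = ((Finset.univ.image toMat : Finset _) : Set _) := by
    rw [← range_signMatrix]; simp [toMat]
  have h2 : signMatrices n ∩ {M | p M.det} =
      (((Finset.univ.filter fun A => p (signDet A)).image toMat : Finset _) : Set _) := by
    rw [← range_signMatrix]
    ext M
    simp only [Set.mem_inter_iff, Set.mem_range, Finset.coe_image, Set.mem_image, Finset.coe_filter]
    constructor
    · rintro ⟨⟨A, rfl⟩, h⟩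
      exact ⟨A, ⟨Finset.mem_univ A, h⟩, rfl⟩
    · rintro ⟨A, ⟨-, h⟩, rfl⟩
      exact ⟨⟨A, rfl⟩, h⟩
  rw [freq_eq_card_div, Measure.real, bernoulliMatrix, uniformOn,
    cond_apply (signMatrices_finite n).measurableSet, h2, h1, Measure.count_apply_finset,
    Measure.count_apply_finset, Finset.card_image_of_injective _ htoMat,
    Finset.card_image_of_injective _ htoMat]
  rw [ENNReal.toReal_mul, ENNReal.toReal_inv, ENNReal.toReal_natCast, ENNReal.toReal_natCast,
    Finset.card_univ, div_eq_inv_mul]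

end UniformMeasure

/-! ### Two-sided bounds for each sign -/

section Bilateral

/-- The events for the determinant and for its negative are equally likely, disjoint because `L n >
0`, and together nearly exhaust the space. -/
lemma tendsto_freq_signDet_mem_bilateral {L U : ℕ → ℝ} (hL : ∀ n, 0 < L n)
    (h1 : Tendsto (fun n : ℕ => freq (fun A : Fin n → Fin n → ℤˣ => ¬ L n ≤ |signDet A|))
      atTop (𝓝 0))
    (h2 : Tendsto (fun n : ℕ => freq (fun A : Fin n → Fin n → ℤˣ => ¬ |signDet A| ≤ U n))
      atTop (𝓝 0)) :
    Tendsto (fun n : ℕ => freq (fun A : Fin n → Fin n → ℤˣ => L n ≤ signDet A ∧ signDet A ≤ U n))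
      atTop (𝓝 (1 / 2)) := by
  have h3 : Tendsto (fun n : ℕ => (1 - freq (fun A : Fin n → Fin n → ℤˣ => ¬ L n ≤ |signDet A|) -
      freq (fun A : Fin n → Fin n → ℤˣ => ¬ |signDet A| ≤ U n)) / 2) atTop (𝓝 (1 / 2)) := by
    simpa using (((tendsto_const_nhds (x := (1 : ℝ))).sub h1).sub h2).div_const (2 : ℝ)
  refine tendsto_of_tendsto_of_tendsto_of_le_of_le' h3 tendsto_const_nhds ?_ ?_
  · filter_upwards [eventually_gt_atTop 0] with n hn
    have hsym := freq_neg_signDet hn fun t => L n ≤ t ∧ t ≤ U n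
    have h4 := freq_not (fun A : Fin n → Fin n → ℤˣ => ¬ L n ≤ |signDet A| ∨ ¬ |signDet A| ≤ U n)
    have h5 := freq_or_le (fun A : Fin n → Fin n → ℤˣ => ¬ L n ≤ |signDet A|)
      fun A => ¬ |signDet A| ≤ U n
    have h6 := freq_or_le (fun A : Fin n → Fin n → ℤˣ => L n ≤ signDet A ∧ signDet A ≤ U n)
      fun A => L n ≤ -signDet A ∧ -signDet A ≤ U n
    have h7 : freq (fun A : Fin n → Fin n → ℤˣ => ¬ (¬ L n ≤ |signDet A| ∨ ¬ |signDet A| ≤ U n)) ≤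
        freq (fun A : Fin n → Fin n → ℤˣ => (L n ≤ signDet A ∧ signDet A ≤ U n) ∨
          (L n ≤ -signDet A ∧ -signDet A ≤ U n)) := freq_mono fun A hA => by
      push Not at hA
      rcases abs_choice (signDet A) with h | h <;> rw [h] at hA
      · exact Or.inl hA
      · exact Or.inr hA
    linarith
  · filter_upwards [eventually_gt_atTop 0] with n hn
    have hsym := freq_neg_signDet hn fun t => L n ≤ t ∧ t ≤ U n
    have h4 := freq_not (fun A : Fin n → Fin n → ℤˣ => L n ≤ signDet A ∧ signDet A ≤ U n)
    have h5 : freq (fun A : Fin n → Fin n → ℤˣ => L n ≤ -signDet A ∧ -signDet A ≤ U n) ≤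
        freq (fun A : Fin n → Fin n → ℤˣ => ¬ (L n ≤ signDet A ∧ signDet A ≤ U n)) :=
      freq_mono fun A hA h => by linarith [hL n, hA.1, h.1]
    linarith

end Bilateral

theorem theorem1p1 :
    Tendsto (fun n : ℕ => (bernoulliMatrix n).real
        {M | √(n ! : ℝ) * Real.exp (-29 * √(n * Real.log n)) ≤ |M.det|})
      atTop (𝓝 1) ∧
    ∃ C : ℝ, 0 < C ∧
      Tendsto (fun n : ℕ => (bernoulliMatrix n).real
          {M | √(n ! : ℝ) * Real.exp (-C * √(n * Real.log n)) ≤ M.det ∧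
            M.det ≤ √(n ! : ℝ) * Real.exp (C * √(n * Real.log n))})
        atTop (𝓝 (1 / 2)) ∧
      Tendsto (fun n : ℕ => (bernoulliMatrix n).real
          {M | √(n ! : ℝ) * Real.exp (-C * √(n * Real.log n)) ≤ -M.det ∧
            -M.det ≤ √(n ! : ℝ) * Real.exp (C * √(n * Real.log n))})
        atTop (𝓝 (1 / 2)) := by
  have hmain := tendsto_freq_signDet_mem_bilateral
    (fun n => mul_pos (Real.sqrt_pos.2 (by exact_mod_cast n.factorial_pos)) (Real.exp_pos _))
    tendsto_freq_not_le_abs_signDet tendsto_freq_not_abs_signDet_le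
  refine ⟨?_, 29, by norm_num, ?_, ?_⟩
  · have h : Tendsto (fun n : ℕ => 1 - freq (fun A : Fin n → Fin n → ℤˣ =>
        ¬ √(n ! : ℝ) * Real.exp (-29 * √(n * Real.log n)) ≤ |signDet A|)) atTop (𝓝 1) := by
      simpa using tendsto_freq_not_le_abs_signDet.const_sub 1
    refine h.congr fun n => ?_
    rw [bernoulliMatrix_real_det n fun t =>
      √(n ! : ℝ) * Real.exp (-29 * √(n * Real.log n)) ≤ |t|, freq_not, sub_sub_cancel]
  · refine hmain.congr fun n => ?_
    rw [bernoulliMatrix_real_det n fun t =>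
      √(n ! : ℝ) * Real.exp (-29 * √(n * Real.log n)) ≤ t ∧
        t ≤ √(n ! : ℝ) * Real.exp (29 * √(n * Real.log n))]
  · refine hmain.congr' ?_
    -- The empty matrix has determinant `1`, so the sign symmetry needs `n > 0`.
    filter_upwards [eventually_gt_atTop 0] with n hn
    rw [bernoulliMatrix_real_det n fun t =>
      √(n ! : ℝ) * Real.exp (-29 * √(n * Real.log n)) ≤ -t ∧
        -t ≤ √(n ! : ℝ) * Real.exp (29 * √(n * Real.log n))]
    exact (freq_neg_signDet hn fun t => √(n ! : ℝ) * Real.exp (-29 * √(n * Real.log n)) ≤ t ∧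
      t ≤ √(n ! : ℝ) * Real.exp (29 * √(n * Real.log n))).symm
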